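/- Let $M$ be a smooth $n$-dimensional manifold (Hausdorff, second countable, without boundary) with a Riemannian metric $g$, let $f\in C^\infty(M)$, and let $\rho=e^{-f}\sqrt{\det g}$ be the corresponding density. In local coordinates $(x^i)$ write $g_{ij}=g(\partial_i,\partial_j)$, $(g^{ij})=(g_{ij})^{-1}$, $\nabla_i=\nabla_{\partial_i}$, and sum over repeated indices. (1) Let $V\to M$ be a smooth real vector bundle of finite rank with a smooth bundle metric $h$, let $\nabla$ be a smooth connection on $V$, and let $\tilde\nabla$ be the dual connection, i.e. $u\,h(Y,Z)=h(\nabla_uY,Z)+h(Y,\tilde\nabla_uZ)$. Then $\nabla:\Gamma(V)\to\Gamma(T^*M\otimes V)$ has a unique formal adjoint $\nabla^*:\Gamma(T^*M\otimes V)\to\Gamma(V)$ with respect to $\rho$, i.e. $\int_M\langle\nabla s,\eta\rangle\,\rho=\int_M h(s,\nabla^*\eta)\,\rho$ for all smooth $\eta$ and all smooth compactly supported $s$, where $\langle\alpha,\beta\rangle=g^{ij}h(\alpha(\partial_i),\beta(\partial_j))$. The vector (Bochner) Laplacian $\Delta=\nabla^*\nabla$ satisfies, for every smooth section $s$ and in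 every chart, $$\Delta s=-g^{ij}\tilde\nabla_j\nabla_i s-\frac1{\sqrt{\det g}}\,\partial_j\!\left(\sqrt{\det g}\,g^{ij}\right)\nabla_i s+g^{ij}\,\partial_jf\,\nabla_i s .$$ (2) Let $(M,g,\nabla)$ be a statistical manifold: $\nabla$ is a smooth torsion-free connection on $TM$ whose dual connection $\tilde\nabla$ with respect to $g$ is torsion-free as well. Let $K_XY=\tilde\nabla_XY-\nabla_XY$ be the difference tensor, $K_{\partial_j}\partial_k=K^i_{jk}\partial_i$, $K^i=g^{jk}K^i_{jk}$, and let $\mathrm{Hess}(X)=\tilde\nabla\nabla X$, where $\tilde\nabla$ is extended to $T^*M\otimes TM$, so that $\mathrm{Tr}(\mathrm{Hess}(X))=g^{ij}\left(\tilde\nabla_j\nabla_iX-\nabla_{\tilde\nabla_j\partial_i}X\right)$. Then $\nabla$ has a unique formal adjoint with respect to $\rho$ (with $V=TM$, $h=g$), and $\Delta=\nabla^*\nabla$ satisfies, for every smooth vector field $X$ and in every chart, $$\Delta X=-\mathrm{Tr}(\mathrm{Hess}(X))-\tfrac12K^i\nabla_iX+g^{ij}\,\partial_jf\,\nabla_iX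 .$$ Equivalently, in terms of the second covariant derivative $\nabla\nabla X$, with $\mathrm{Tr}(\nabla\nabla X)=g^{ij}\left(\nabla_j\nabla_iX-\nabla_{\nabla_j\partial_i}X\right)$, $$\Delta X=-\mathrm{Tr}(\nabla\nabla X)-g^{ij}K_{\partial_j}(\nabla_iX)+\tfrac12K^i\nabla_iX+g^{ij}\,\partial_jf\,\nabla_iX .$$ -/

import Mathlib

open Bundle MeasureTheory
open scoped Manifold ContDiff Matrix

noncomputable section

namespace StatLaplacian

/-! Throughout, `M` is a smooth manifold without boundary modelled on `ℝⁿ`, and a chart is an element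
`e` of its smooth maximal atlas. In Mathlib, `cov s x u` is the covariant derivative `(∇_u s)(x)`. -/

section Coordinates

variable {n : ℕ} {M : Type*} [TopologicalSpace M] [ChartedSpace (EuclideanSpace ℝ (Fin n)) M]

/-- The coordinate vector field `∂_i` of the chart `e` (used only on `e.source`): the pullback by `e`
of the `i`-th standard constant vector field of `ℝⁿ`. -/
def coordField (e : OpenPartialHomeomorph M (EuclideanSpace ℝ (Fin n))) (i : Fin n) :
    (x : M) → TangentSpace (𝓡 n) x :=
  VectorField.mpullback (𝓡 n) (𝓡 n) e (fun _ ↦ EuclideanSpace.single i (1 : ℝ))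

/-- The `i`-th component `v^i = dx^i(v)` of a tangent vector `v` at `x` in the chart `e`. -/
def coordComponent (e : OpenPartialHomeomorph M (EuclideanSpace ℝ (Fin n))) (i : Fin n) (x : M)
    (v : TangentSpace (𝓡 n) x) : ℝ :=
  (show EuclideanSpace ℝ (Fin n) from mfderiv (𝓡 n) (𝓡 n) e x v) i

/-- The partial derivative `∂_i φ` at `x` of a scalar function in the coordinates given by `e`. -/
def partialDeriv (e : OpenPartialHomeomorph M (EuclideanSpace ℝ (Fin n))) (i : Fin n) (φ : M → ℝ)
    (x : M) : ℝ :=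
  fderiv ℝ (φ ∘ e.symm) (e x) (EuclideanSpace.single i 1)

variable [IsManifold (𝓡 n) ∞ M]
  (g : ContMDiffRiemannianMetric (𝓡 n) ∞ (EuclideanSpace ℝ (Fin n))
    (fun x : M ↦ TangentSpace (𝓡 n) x))

/-- The matrix `g_{ij} = g(∂_i, ∂_j)` at `x` in the chart `e`. Its inverse is `g^{ij}`. -/
def metricMatrix (e : OpenPartialHomeomorph M (EuclideanSpace ℝ (Fin n))) (x : M) :
    Matrix (Fin n) (Fin n) ℝ :=
  Matrix.of fun i j ↦ g.inner x (coordField e i x) (coordField e j x)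

/-- `√det g` in the chart `e`. -/
def sqrtDet (e : OpenPartialHomeomorph M (EuclideanSpace ℝ (Fin n))) (x : M) : ℝ :=
  Real.sqrt (metricMatrix g e x).det

end Coordinates

section Volume

variable {n : ℕ} {M : Type*} [TopologicalSpace M] [ChartedSpace (EuclideanSpace ℝ (Fin n)) M]
  [IsManifold (𝓡 n) ∞ M] [MeasurableSpace M]
  (g : ContMDiffRiemannianMetric (𝓡 n) ∞ (EuclideanSpace ℝ (Fin n))
    (fun x : M ↦ TangentSpace (𝓡 n) x))

/-- The measure `√det g dx¹ ⋯ dxⁿ` on the domain of the chart `e`, extended by zero to `M`. -/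
def chartVolume (e : OpenPartialHomeomorph M (EuclideanSpace ℝ (Fin n))) : Measure M :=
  (((volume : Measure (EuclideanSpace ℝ (Fin n))).restrict e.target).withDensity
    fun y ↦ ENNReal.ofReal (sqrtDet g e (e.symm y))).map e.symm

/-- The Riemannian measure of `g`: the least measure on `M` that dominates `√det g dx¹ ⋯ dxⁿ` in
every chart. As these chart measures agree on overlaps (change of variables) and countably many
charts cover a second countable `M`, it restricts to `√det g dx¹ ⋯ dxⁿ` on the domain of each
chart. -/
def riemannianMeasure : Measure M :=
  ⨆ e ∈ IsManifold.maximalAtlas (𝓡 n) ∞ M, chartVolume g e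

/-- The measure with density `ρ = e^{-f} √det g`. -/
def weightedMeasure (f : M → ℝ) : Measure M :=
  (riemannianMeasure g).withDensity fun x ↦ ENNReal.ofReal (Real.exp (-f x))

end Volume

section Connections

variable {n : ℕ} {M : Type*} [TopologicalSpace M] [ChartedSpace (EuclideanSpace ℝ (Fin n)) M]
  [IsManifold (𝓡 n) ∞ M]
  (g : ContMDiffRiemannianMetric (𝓡 n) ∞ (EuclideanSpace ℝ (Fin n))
    (fun x : M ↦ TangentSpace (𝓡 n) x))
  {F : Type*} [NormedAddCommGroup F] [NormedSpace ℝ F]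
  {V : M → Type*} [TopologicalSpace (TotalSpace F V)]
  [∀ x, AddCommGroup (V x)] [∀ x, Module ℝ (V x)] [∀ x, TopologicalSpace (V x)]
  [∀ x, IsTopologicalAddGroup (V x)] [∀ x, ContinuousSMul ℝ (V x)]
  [FiberBundle F V] [VectorBundle ℝ F V]
  (h : ContMDiffRiemannianMetric (𝓡 n) ∞ F V)

/-- The connections `cov = ∇` and `cov' = ∇̃` on `V` are dual with respect to the bundle metric `h`:
`u h(Y, Z) = h(∇_u Y, Z) + h(Y, ∇̃_u Z)`. -/
def IsDual (cov cov' : CovariantDerivative (𝓡 n) F V) : Prop :=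
  ∀ (Y Z : (x : M) → V x) (x : M),
    MDifferentiableAt (𝓡 n) ((𝓡 n).prod 𝓘(ℝ, F)) (fun y ↦ TotalSpace.mk' F y (Y y)) x →
    MDifferentiableAt (𝓡 n) ((𝓡 n).prod 𝓘(ℝ, F)) (fun y ↦ TotalSpace.mk' F y (Z y)) x →
    ∀ u : TangentSpace (𝓡 n) x,
      mvfderiv (𝓡 n) (fun y ↦ h.inner y (Y y) (Z y)) x u =
        h.inner x (cov Y x u) (Z x) + h.inner x (Y x) (cov' Z x u)

/-- The inner product induced by `g` and `h` on the fibre at `x` of `T*M ⊗ V = Hom(TM, V)`: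
`⟨α, β⟩ = g^{ij} h(α(∂_i), β(∂_j))`, written in the preferred chart at `x` (it does not depend on
the chart). -/
def homInner (x : M) (α β : TangentSpace (𝓡 n) x →L[ℝ] V x) : ℝ :=
  ∑ i, ∑ j, (metricMatrix g (chartAt (EuclideanSpace ℝ (Fin n)) x) x)⁻¹ i j *
    h.inner x (α (coordField (chartAt (EuclideanSpace ℝ (Fin n)) x) i x))
      (β (coordField (chartAt (EuclideanSpace ℝ (Fin n)) x) j x))

/-- A smooth connection as a map `∇ : Γ(V) → Γ(T*M ⊗ V)` between smooth sections. -/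
def covSection (cov : CovariantDerivative (𝓡 n) F V) [CovariantDerivative.ContMDiffCovariantDerivative cov ∞]
    (s : Cₛ^∞⟮𝓡 n; F, V⟯) :
    Cₛ^∞⟮𝓡 n; EuclideanSpace ℝ (Fin n) →L[ℝ] F, fun x : M ↦ TangentSpace (𝓡 n) x →L[ℝ] V x⟯ where
  toFun := cov s
  contMDiff_toFun := by
    have hc := CovariantDerivative.ContMDiffCovariantDerivative.contMDiff (cov := cov) (k := ∞)
    exact contMDiffOn_univ.1 (hc.contMDiff (σ := s) (by simpa using s.contMDiff.contMDiffOn))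

variable [MeasurableSpace M]

/-- `A : Γ(T*M ⊗ V) → Γ(V)` is a formal adjoint `∇*` of `∇` with respect to the density
`ρ = e^{-f} √det g`: `∫ ⟨∇s, η⟩ ρ = ∫ h(s, A η) ρ` for all smooth `η` and all smooth compactly
supported `s`. -/
def IsFormalAdjoint (f : M → ℝ) (cov : CovariantDerivative (𝓡 n) F V)
    [CovariantDerivative.ContMDiffCovariantDerivative cov ∞]
    (A : Cₛ^∞⟮𝓡 n; EuclideanSpace ℝ (Fin n) →L[ℝ] F,
        fun x : M ↦ TangentSpace (𝓡 n) x →L[ℝ] V x⟯ → Cₛ^∞⟮𝓡 n; F, V⟯) : Prop :=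
  ∀ (η : Cₛ^∞⟮𝓡 n; EuclideanSpace ℝ (Fin n) →L[ℝ] F,
      fun x : M ↦ TangentSpace (𝓡 n) x →L[ℝ] V x⟯) (s : Cₛ^∞⟮𝓡 n; F, V⟯),
    IsCompact (closure {x | s x ≠ 0}) →
    ∫ x, homInner g h x (covSection cov s x) (η x) ∂(weightedMeasure g f) =
      ∫ x, h.inner x (s x) (A η x) ∂(weightedMeasure g f)

end Connections

section Tangent

variable {n : ℕ} {M : Type*} [TopologicalSpace M] [ChartedSpace (EuclideanSpace ℝ (Fin n)) M]
  [IsManifold (𝓡 n) ∞ M]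
  (g : ContMDiffRiemannianMetric (𝓡 n) ∞ (EuclideanSpace ℝ (Fin n))
    (fun x : M ↦ TangentSpace (𝓡 n) x))

/-- `(M, g, ∇)` with `cov = ∇` is a statistical manifold with dual connection `cov' = ∇̃`: the two
connections on `TM` are dual with respect to `g` and both torsion-free (for torsion-free `∇`,
the latter says that the cubic tensor `∇g` is totally symmetric). -/
structure IsStatistical (cov cov' : CovariantDerivative (𝓡 n) (EuclideanSpace ℝ (Fin n))
    (fun x : M ↦ TangentSpace (𝓡 n) x)) : Prop where
  dual : IsDual g cov cov'
  torsion_eq_zero : cov.torsion = 0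
  torsion_eq_zero' : cov'.torsion = 0

/-- The second covariant derivative of `X` formed with an inner connection `∇ = cov` and an outer
connection `D = cov'`, i.e. the derivative of `∇X ∈ Γ(T*M ⊗ TM)` by the connection that `D` induces
on `T*M ⊗ TM`: `(D∇X)(Y, Z) = D_Y (∇_Z X) - ∇_{D_Y Z} X`, at the point `x`. -/
def secondCov (cov cov' : CovariantDerivative (𝓡 n) (EuclideanSpace ℝ (Fin n))
    (fun x : M ↦ TangentSpace (𝓡 n) x)) (X Y Z : (x : M) → TangentSpace (𝓡 n) x) (x : M) :
    TangentSpace (𝓡 n) x :=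
  cov' (fun y ↦ cov X y (Z y)) x (Y x) - cov X x (cov' Z x (Y x))

/-- The trace `g^{ij} (D∇X)(∂_j, ∂_i)` at `x`, computed in the chart `e`. -/
def traceSecondCov (cov cov' : CovariantDerivative (𝓡 n) (EuclideanSpace ℝ (Fin n))
    (fun x : M ↦ TangentSpace (𝓡 n) x)) (e : OpenPartialHomeomorph M (EuclideanSpace ℝ (Fin n)))
    (X : (x : M) → TangentSpace (𝓡 n) x) (x : M) : TangentSpace (𝓡 n) x :=
  ∑ i, ∑ j, (metricMatrix g e x)⁻¹ i j •
    secondCov cov cov' X (coordField e j) (coordField e i) x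

/-- The difference tensor `K_u v = ∇̃_u v - ∇_u v` at `x`, for `cov = ∇` and `cov' = ∇̃`. -/
def diffTensor (cov cov' : CovariantDerivative (𝓡 n) (EuclideanSpace ℝ (Fin n))
    (fun x : M ↦ TangentSpace (𝓡 n) x)) (x : M) (u v : TangentSpace (𝓡 n) x) :
    TangentSpace (𝓡 n) x :=
  CovariantDerivative.difference cov' cov x v u

/-- `K^i = g^{jk} K^i_{jk}`, the components of the metric trace of the difference tensor in the
chart `e`, where `K_{∂_j} ∂_k = K^i_{jk} ∂_i`. -/
def diffTrace (cov cov' : CovariantDerivative (𝓡 n) (EuclideanSpace ℝ (Fin n))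
    (fun x : M ↦ TangentSpace (𝓡 n) x)) (e : OpenPartialHomeomorph M (EuclideanSpace ℝ (Fin n)))
    (i : Fin n) (x : M) : ℝ :=
  ∑ j, ∑ k, (metricMatrix g e x)⁻¹ j k *
    coordComponent e i x (diffTensor cov cov' x (coordField e j x) (coordField e k x))

end Tangent

end StatLaplacian

end

/-! In a single chart the theorem is integration by parts. With ρ = e^{-f} √det g and η_i = η(∂_i),
the product rule and the duality ∂_j h(s,t) = h(∇_j s, t) + h(s, ∇̃_j t) give the pointwise identity
∂_j(ρ g^{ij} h(s, η_i)) = ρ (⟨∇s, η⟩ - h(s, Aη)), where A is `localAdjoint` (`sum_partialDeriv_eq`).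
For s with compact support in the chart the left side integrates to zero
(`integral_partialDeriv_eq_zero`), so A is adjoint to ∇ on such sections.

Testing a smooth section D against ψD, with ψ a bump function, shows that D is determined by its
integral pairings (`eq_zero_of_integral_inner_eq_zero`). This serves twice: it gives uniqueness of
the adjoint, and it forces the expressions A of two charts to agree on the overlap
(`localAdjoint_eq`), so no transformation law for A has to be computed. The local expressions
therefore glue to `adjoint`, and a partition of unity extends adjointness to all compactly supported
s. Part (1) is the case η = ∇s. Two preparations are needed: the supremum defining the Riemannian
measure must be identified in each chart (`riemannianMeasure_restrict_source`), and smoothness of ∇̃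
must be deduced from duality (`contMDiffAt_dual_coordField`).

For part (2) only the vector (1/√det g) ∂_j(√det g g^{ij}) ∂_i has to be rewritten. Jacobi's formula
and the derivative of an inverse matrix express it through derivatives of g; duality and the
vanishing of both torsions then turn it into -½ g^{jk}(∇_j ∂_k + ∇̃_j ∂_k)
(`sum_partialDeriv_sqrtDet_mul_inv`). The trace of the Hessian involves g^{jk} ∇̃_j ∂_k instead, and
the discrepancy is the term ½ K^i ∇_i X. Writing the outer ∇̃ as ∇ + K gives the second form. -/

set_option linter.unusedSectionVars false

noncomputable section

namespace StatLaplacian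

open scoped Topology

/-! ### Charts, coordinate vector fields and partial derivatives. -/

section Charts

variable {n : ℕ} {M : Type*} [TopologicalSpace M] [ChartedSpace (EuclideanSpace ℝ (Fin n)) M]
  [IsManifold (𝓡 n) ∞ M] {e e' : OpenPartialHomeomorph M (EuclideanSpace ℝ (Fin n))} {x : M}

lemma mdifferentiable_of_mem_maximalAtlas (he : e ∈ IsManifold.maximalAtlas (𝓡 n) ∞ M) :
    e.MDifferentiable (𝓡 n) (𝓡 n) :=
  ⟨(contMDiffOn_of_mem_maximalAtlas he).mdifferentiableOn (by simp),
    (contMDiffOn_symm_of_mem_maximalAtlas he).mdifferentiableOn (by simp)⟩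

/-- The derivative of a chart as a linear equivalence. -/
def chartEquiv (he : e ∈ IsManifold.maximalAtlas (𝓡 n) ∞ M) (hx : x ∈ e.source) :
    TangentSpace (𝓡 n) x ≃L[ℝ] EuclideanSpace ℝ (Fin n) :=
  (mdifferentiable_of_mem_maximalAtlas he).mfderiv hx

lemma isInvertible_mfderiv_chart (he : e ∈ IsManifold.maximalAtlas (𝓡 n) ∞ M)
    (hx : x ∈ e.source) : (mfderiv (𝓡 n) (𝓡 n) e x).IsInvertible :=
  ⟨chartEquiv he hx, rfl⟩

lemma coordField_eq (he : e ∈ IsManifold.maximalAtlas (𝓡 n) ∞ M) (hx : x ∈ e.source) (i : Fin n) :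
    coordField e i x = (chartEquiv he hx).symm (EuclideanSpace.single i 1) := by
  let L : TangentSpace (𝓡 n) x ≃L[ℝ] TangentSpace (𝓡 n) (e x) :=
    (mdifferentiable_of_mem_maximalAtlas he).mfderiv hx
  have h : mfderiv (𝓡 n) (𝓡 n) e x = (L : TangentSpace (𝓡 n) x →L[ℝ] _) := rfl
  -- The pullback is defined with `ContinuousLinearMap.inverse`, which is zero by default on
  -- non-invertible maps; the derivative of a chart is invertible, so this is the true inverse.
  have h' : (mfderiv (𝓡 n) (𝓡 n) e x).inverse = (L.symm : _ →L[ℝ] TangentSpace (𝓡 n) x) := by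
    rw [h, ContinuousLinearMap.inverse_equiv]
  exact congrArg (fun T : TangentSpace (𝓡 n) (e x) →L[ℝ] TangentSpace (𝓡 n) x ↦
    T (EuclideanSpace.single i (1 : ℝ) : EuclideanSpace ℝ (Fin n))) h'

lemma chartEquiv_coordField (he : e ∈ IsManifold.maximalAtlas (𝓡 n) ∞ M) (hx : x ∈ e.source)
    (i : Fin n) : chartEquiv he hx (coordField e i x) = EuclideanSpace.single i 1 := by
  rw [coordField_eq he hx]; simp

lemma coordComponent_eq (he : e ∈ IsManifold.maximalAtlas (𝓡 n) ∞ M) (hx : x ∈ e.source)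
    (i : Fin n) (v : TangentSpace (𝓡 n) x) : coordComponent e i x v = chartEquiv he hx v i := rfl

lemma sum_coordComponent_smul (he : e ∈ IsManifold.maximalAtlas (𝓡 n) ∞ M) (hx : x ∈ e.source)
    (v : TangentSpace (𝓡 n) x) : ∑ i, coordComponent e i x v • coordField e i x = v := by
  apply (chartEquiv he hx).injective
  rw [map_sum]
  simp only [map_smul, chartEquiv_coordField, coordComponent_eq he hx]
  ext j
  simp [Pi.single_apply]

/-- The coordinate vector fields of a chart form a basis of each tangent space. -/
def coordBasis (he : e ∈ IsManifold.maximalAtlas (𝓡 n) ∞ M) (hx : x ∈ e.source) :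
    Module.Basis (Fin n) ℝ (TangentSpace (𝓡 n) x) :=
  (EuclideanSpace.basisFun (Fin n) ℝ).toBasis.map (chartEquiv he hx).symm.toLinearEquiv

lemma coordBasis_apply (he : e ∈ IsManifold.maximalAtlas (𝓡 n) ∞ M) (hx : x ∈ e.source)
    (i : Fin n) : coordBasis he hx i = coordField e i x := by
  rw [coordField_eq he hx]; simp [coordBasis]

lemma contMDiffAt_coordField (he : e ∈ IsManifold.maximalAtlas (𝓡 n) ∞ M) (hx : x ∈ e.source)
    (i : Fin n) : ContMDiffAt (𝓡 n) ((𝓡 n).prod (𝓡 n)) ∞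
      (fun y ↦ (TotalSpace.mk' (EuclideanSpace ℝ (Fin n)) y (coordField e i y) :
        TangentBundle (𝓡 n) M)) x := by
  refine ContMDiffAt.mpullback_vectorField_preimage (n := ∞) ?_
    (contMDiffAt_of_mem_maximalAtlas he hx) (isInvertible_mfderiv_chart he hx) (by simp)
  exact contMDiffAt_vectorSpace_iff_contDiffAt.2 contDiffAt_const

lemma contDiffAt_comp_symm {φ : M → ℝ} (he : e ∈ IsManifold.maximalAtlas (𝓡 n) ∞ M)
    (hx : x ∈ e.source) (hφ : ContMDiffAt (𝓡 n) 𝓘(ℝ, ℝ) ∞ φ x) :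
    ContDiffAt ℝ ∞ (φ ∘ e.symm) (e x) := by
  rw [← contMDiffAt_iff_contDiffAt]
  refine ContMDiffAt.comp (I' := 𝓡 n) (e x) ?_
    (contMDiffAt_symm_of_mem_maximalAtlas he (e.map_source hx))
  rwa [e.left_inv hx]

lemma differentiableAt_comp_symm {φ : M → ℝ} (he : e ∈ IsManifold.maximalAtlas (𝓡 n) ∞ M)
    (hx : x ∈ e.source) (hφ : ContMDiffAt (𝓡 n) 𝓘(ℝ, ℝ) ∞ φ x) :
    DifferentiableAt ℝ (φ ∘ e.symm) (e x) :=
  (contDiffAt_comp_symm he hx hφ).differentiableAt (by simp)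

lemma contMDiffAt_partialDeriv {φ : M → ℝ} (he : e ∈ IsManifold.maximalAtlas (𝓡 n) ∞ M)
    (hx : x ∈ e.source) (hφ : ContMDiffAt (𝓡 n) 𝓘(ℝ, ℝ) ∞ φ x) (i : Fin n) :
    ContMDiffAt (𝓡 n) 𝓘(ℝ, ℝ) ∞ (partialDeriv e i φ) x := by
  have h1 : ContDiffAt ℝ ∞ (fun y ↦ fderiv ℝ (φ ∘ e.symm) y (EuclideanSpace.single i 1)) (e x) :=
    ((contDiffAt_comp_symm he hx hφ).fderiv_right (m := ∞) (by simp)).clm_apply contDiffAt_const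
  exact ContMDiffAt.comp (I' := 𝓡 n) x h1.contMDiffAt (contMDiffAt_of_mem_maximalAtlas he hx)

/-- Chain rule for φ = (φ ∘ e.symm) ∘ e near x. It connects the coordinate derivatives of the
formulas with the invariant derivative in the definition of duality. -/
lemma partialDeriv_eq_mvfderiv {φ : M → ℝ} (he : e ∈ IsManifold.maximalAtlas (𝓡 n) ∞ M)
    (hx : x ∈ e.source) (hφ : ContMDiffAt (𝓡 n) 𝓘(ℝ, ℝ) ∞ φ x) (i : Fin n) :
    partialDeriv e i φ x = mvfderiv (𝓡 n) φ x (coordField e i x) := by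
  have hd := differentiableAt_comp_symm he hx hφ
  have h1 : mfderiv (𝓡 n) 𝓘(ℝ, ℝ) φ x =
      (mfderiv (𝓡 n) 𝓘(ℝ, ℝ) (φ ∘ e.symm) (e x)).comp (mfderiv (𝓡 n) (𝓡 n) e x) := by
    rw [← mfderiv_comp x hd.mdifferentiableAt
      ((mdifferentiable_of_mem_maximalAtlas he).mdifferentiableAt hx)]
    apply Filter.EventuallyEq.mfderiv_eq
    filter_upwards [e.open_source.mem_nhds hx] with y hy
    simp [e.left_inv hy]
  have h2 : mvfderiv (𝓡 n) φ x (coordField e i x) =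
      fderiv ℝ (φ ∘ e.symm) (e x) (chartEquiv he hx (coordField e i x)) := by
    rw [← mfderiv_eq_fderiv, mvfderiv, h1]
    rfl
  rw [h2, chartEquiv_coordField, partialDeriv]

lemma partialDeriv_mul {φ ψ : M → ℝ} (he : e ∈ IsManifold.maximalAtlas (𝓡 n) ∞ M)
    (hx : x ∈ e.source) (hφ : ContMDiffAt (𝓡 n) 𝓘(ℝ, ℝ) ∞ φ x)
    (hψ : ContMDiffAt (𝓡 n) 𝓘(ℝ, ℝ) ∞ ψ x) (i : Fin n) :
    partialDeriv e i (fun y ↦ φ y * ψ y) x =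
      partialDeriv e i φ x * ψ x + φ x * partialDeriv e i ψ x := by
  have h : (fun y ↦ φ y * ψ y) ∘ e.symm = (φ ∘ e.symm) * (ψ ∘ e.symm) := rfl
  simp only [partialDeriv]
  rw [h, fderiv_mul (differentiableAt_comp_symm he hx hφ) (differentiableAt_comp_symm he hx hψ)]
  simp [e.left_inv hx]
  ring

lemma partialDeriv_sum {ι : Type*} {s : Finset ι} {φ : ι → M → ℝ}
    (he : e ∈ IsManifold.maximalAtlas (𝓡 n) ∞ M)
    (hx : x ∈ e.source) (hφ : ∀ a ∈ s, ContMDiffAt (𝓡 n) 𝓘(ℝ, ℝ) ∞ (φ a) x) (i : Fin n) :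
    partialDeriv e i (fun y ↦ ∑ a ∈ s, φ a y) x = ∑ a ∈ s, partialDeriv e i (φ a) x := by
  have h : (fun y ↦ ∑ a ∈ s, φ a y) ∘ e.symm = fun y ↦ ∑ a ∈ s, (φ a ∘ e.symm) y := rfl
  simp only [partialDeriv]
  rw [h, fderiv_fun_sum fun a ha ↦ differentiableAt_comp_symm he hx (hφ a ha)]
  simp

lemma partialDeriv_exp_neg {φ : M → ℝ} (he : e ∈ IsManifold.maximalAtlas (𝓡 n) ∞ M)
    (hx : x ∈ e.source) (hφ : ContMDiffAt (𝓡 n) 𝓘(ℝ, ℝ) ∞ φ x) (i : Fin n) :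
    partialDeriv e i (fun y ↦ Real.exp (-φ y)) x =
      -(Real.exp (-φ x) * partialDeriv e i φ x) := by
  have h : (fun y ↦ Real.exp (-φ y)) ∘ e.symm = fun y ↦ Real.exp ((-(φ ∘ e.symm)) y) := rfl
  simp only [partialDeriv]
  rw [h, fderiv_exp (differentiableAt_comp_symm he hx hφ).neg, fderiv_neg]
  simp [e.left_inv hx]

lemma partialDeriv_congr {φ ψ : M → ℝ} (hx : x ∈ e.source) (h : φ =ᶠ[𝓝 x] ψ) (i : Fin n) :
    partialDeriv e i φ x = partialDeriv e i ψ x := by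
  simp only [partialDeriv]
  rw [Filter.EventuallyEq.fderiv_eq]
  have h1 : Filter.Tendsto e.symm (𝓝 (e x)) (𝓝 x) := by
    have := (e.continuousAt_symm (e.map_source hx)).tendsto
    rwa [e.left_inv hx] at this
  exact h1.eventually h

end Charts

/-! ### Smoothness of matrix operations and of bundle metrics. -/

section MatrixSmooth

variable {n : ℕ} {M : Type*} [TopologicalSpace M] [ChartedSpace (EuclideanSpace ℝ (Fin n)) M]
  {ι : Type*} [Fintype ι] [DecidableEq ι] {x : M}

lemma contMDiffAt_det {G : M → Matrix ι ι ℝ}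
    (hG : ∀ i j, ContMDiffAt (𝓡 n) 𝓘(ℝ, ℝ) ∞ (fun y ↦ G y i j) x) :
    ContMDiffAt (𝓡 n) 𝓘(ℝ, ℝ) ∞ (fun y ↦ (G y).det) x := by
  simp only [Matrix.det_apply']
  exact contMDiffAt_finsetSum fun σ _ ↦ contMDiffAt_const.mul
    (contMDiffAt_finsetProd fun i _ ↦ hG _ _)

/-- By Cramer's rule the entries are determinants of modified matrices divided by the determinant.
-/
lemma contMDiffAt_matrix_inv {G : M → Matrix ι ι ℝ}
    (hG : ∀ i j, ContMDiffAt (𝓡 n) 𝓘(ℝ, ℝ) ∞ (fun y ↦ G y i j) x) (hdet : (G x).det ≠ 0)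
    (i j : ι) : ContMDiffAt (𝓡 n) 𝓘(ℝ, ℝ) ∞ (fun y ↦ (G y)⁻¹ i j) x := by
  simp only [Matrix.inv_def, Matrix.smul_apply, Ring.inverse_eq_inv', smul_eq_mul,
    Matrix.adjugate_apply]
  refine ((contDiffAt_inv ℝ hdet).contMDiffAt.comp x (contMDiffAt_det hG)).mul
    (contMDiffAt_det fun k l ↦ ?_)
  by_cases h : k = j
  · subst h; simpa using contMDiffAt_const
  · simpa [Matrix.updateRow_apply, h] using hG k l

end MatrixSmooth

section Inner

variable {n : ℕ} {M : Type*} [TopologicalSpace M] [ChartedSpace (EuclideanSpace ℝ (Fin n)) M]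
  {F : Type*} [NormedAddCommGroup F] [NormedSpace ℝ F]
  {V : M → Type*} [TopologicalSpace (TotalSpace F V)]
  [∀ x, AddCommGroup (V x)] [∀ x, Module ℝ (V x)] [∀ x, TopologicalSpace (V x)]
  [∀ x, IsTopologicalAddGroup (V x)] [∀ x, ContinuousSMul ℝ (V x)]
  [FiberBundle F V] [VectorBundle ℝ F V]
  (h : ContMDiffRiemannianMetric (𝓡 n) ∞ F V) {x : M}

lemma contMDiffAt_inner {s t : (y : M) → V y}
    (hs : ContMDiffAt (𝓡 n) ((𝓡 n).prod 𝓘(ℝ, F)) ∞ (fun y ↦ TotalSpace.mk' F y (s y)) x)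
    (ht : ContMDiffAt (𝓡 n) ((𝓡 n).prod 𝓘(ℝ, F)) ∞ (fun y ↦ TotalSpace.mk' F y (t y)) x) :
    ContMDiffAt (𝓡 n) 𝓘(ℝ, ℝ) ∞ (fun y ↦ h.inner y (s y) (t y)) x := by
  have : ContMDiffAt (𝓡 n) ((𝓡 n).prod 𝓘(ℝ)) ∞
      (fun m ↦ TotalSpace.mk' ℝ (E := Bundle.Trivial M ℝ) m (h.inner m (s m) (t m))) x :=
    ContMDiffAt.clm_bundle_apply₂ (F₁ := F) (F₂ := F) h.contMDiff.contMDiffAt hs ht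
  simp only [contMDiffAt_totalSpace] at this
  exact this.2

/-- The quadratic form of the Gram matrix at c is the squared length of Σ c_i v_i. -/
lemma posDef_gram {ι : Type*} [Fintype ι] {v : ι → V x} (hv : LinearIndependent ℝ v) :
    (Matrix.of fun i j ↦ h.inner x (v i) (v j)).PosDef := by
  refine Matrix.PosDef.of_dotProduct_mulVec_pos ?_ fun c hc ↦ ?_
  · ext i j
    simpa using h.symm _ _ _
  · let w : V x := ∑ i, c i • v i
    have hw : w ≠ 0 := fun h0 ↦ hc (funext (Fintype.linearIndependent_iff.1 hv c h0))
    have key : star c ⬝ᵥ ((Matrix.of fun i j ↦ h.inner x (v i) (v j)) *ᵥ c) =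
        h.inner x w w := by
      simp only [w, map_sum, map_smul, sum_apply, smul_apply,
        dotProduct, Matrix.mulVec, Matrix.of_apply, star_trivial, smul_eq_mul, Finset.mul_sum]
      rw [Finset.sum_comm]
      refine Finset.sum_congr rfl fun i _ ↦ Finset.sum_congr rfl fun j _ ↦ ?_
      ring
    rw [key]
    exact h.pos x w hw

lemma inner_eq_of_forall {u v : V x} (H : ∀ w, h.inner x w u = h.inner x w v) : u = v := by
  by_contra hne
  have hpos := h.pos x (u - v) (sub_ne_zero.2 hne)
  rw [map_sub, H, sub_self] at hpos
  exact lt_irrefl _ hpos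

end Inner

/-! ### The metric under a change of coordinates. -/

section Metric

variable {n : ℕ} {M : Type*} [TopologicalSpace M] [ChartedSpace (EuclideanSpace ℝ (Fin n)) M]
  [IsManifold (𝓡 n) ∞ M] {e e' : OpenPartialHomeomorph M (EuclideanSpace ℝ (Fin n))} {x : M}
  (g : ContMDiffRiemannianMetric (𝓡 n) ∞ (EuclideanSpace ℝ (Fin n))
    (fun x : M ↦ TangentSpace (𝓡 n) x))

lemma metricMatrix_apply (i j : Fin n) :
    metricMatrix g e x i j = g.inner x (coordField e i x) (coordField e j x) := rfl

lemma metricMatrix_symm (i j : Fin n) : metricMatrix g e x i j = metricMatrix g e x j i :=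
  g.symm _ _ _

lemma metricMatrix_inv_symm (i j : Fin n) :
    (metricMatrix g e x)⁻¹ i j = (metricMatrix g e x)⁻¹ j i := by
  have h : (metricMatrix g e x)ᵀ = metricMatrix g e x := by
    ext i j; exact metricMatrix_symm g j i
  conv_lhs => rw [← h, ← Matrix.transpose_nonsing_inv]
  rfl

lemma posDef_metricMatrix (he : e ∈ IsManifold.maximalAtlas (𝓡 n) ∞ M) (hx : x ∈ e.source) :
    (metricMatrix g e x).PosDef := by
  refine posDef_gram g (v := fun i ↦ coordField e i x) ?_
  have := (coordBasis he hx).linearIndependent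
  rwa [show ⇑(coordBasis he hx) = fun i ↦ coordField e i x from
    funext (coordBasis_apply he hx)] at this

lemma det_metricMatrix_pos (he : e ∈ IsManifold.maximalAtlas (𝓡 n) ∞ M) (hx : x ∈ e.source) :
    0 < (metricMatrix g e x).det := (posDef_metricMatrix g he hx).det_pos

lemma sqrtDet_pos (he : e ∈ IsManifold.maximalAtlas (𝓡 n) ∞ M) (hx : x ∈ e.source) :
    0 < sqrtDet g e x := Real.sqrt_pos.2 (det_metricMatrix_pos g he hx)

lemma contMDiffAt_metricMatrix (he : e ∈ IsManifold.maximalAtlas (𝓡 n) ∞ M) (hx : x ∈ e.source)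
    (i j : Fin n) : ContMDiffAt (𝓡 n) 𝓘(ℝ, ℝ) ∞ (fun y ↦ metricMatrix g e y i j) x :=
  contMDiffAt_inner g (contMDiffAt_coordField he hx i) (contMDiffAt_coordField he hx j)

lemma contMDiffAt_metricMatrix_inv (he : e ∈ IsManifold.maximalAtlas (𝓡 n) ∞ M)
    (hx : x ∈ e.source) (i j : Fin n) :
    ContMDiffAt (𝓡 n) 𝓘(ℝ, ℝ) ∞ (fun y ↦ (metricMatrix g e y)⁻¹ i j) x :=
  contMDiffAt_matrix_inv (contMDiffAt_metricMatrix g he hx) (det_metricMatrix_pos g he hx).ne' i j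

lemma contMDiffAt_sqrtDet (he : e ∈ IsManifold.maximalAtlas (𝓡 n) ∞ M) (hx : x ∈ e.source) :
    ContMDiffAt (𝓡 n) 𝓘(ℝ, ℝ) ∞ (sqrtDet g e) x :=
  (Real.contDiffAt_sqrt (det_metricMatrix_pos g he hx).ne').contMDiffAt.comp x
    (contMDiffAt_det (contMDiffAt_metricMatrix g he hx))

/-- The Jacobian matrix of the coordinates `e'` with respect to the coordinates `e`. -/
def transitionMatrix (e e' : OpenPartialHomeomorph M (EuclideanSpace ℝ (Fin n))) (x : M) :
    Matrix (Fin n) (Fin n) ℝ :=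
  Matrix.of fun k i ↦ coordComponent e' k x (coordField e i x)

lemma coordField_eq_sum (he' : e' ∈ IsManifold.maximalAtlas (𝓡 n) ∞ M) (hx' : x ∈ e'.source)
    (i : Fin n) :
    coordField e i x = ∑ k, transitionMatrix e e' x k i • coordField e' k x :=
  (sum_coordComponent_smul he' hx' _).symm

lemma matrix_bilin_eq (he' : e' ∈ IsManifold.maximalAtlas (𝓡 n) ∞ M) (hx' : x ∈ e'.source)
    (b : TangentSpace (𝓡 n) x →ₗ[ℝ] TangentSpace (𝓡 n) x →ₗ[ℝ] ℝ) :
    (Matrix.of fun i j ↦ b (coordField e i x) (coordField e j x)) =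
      (transitionMatrix e e' x)ᵀ *
        (Matrix.of fun i j ↦ b (coordField e' i x) (coordField e' j x)) *
          transitionMatrix e e' x := by
  ext i j
  simp only [Matrix.mul_apply, Matrix.transpose_apply, Matrix.of_apply]
  rw [coordField_eq_sum (e := e) he' hx' i, coordField_eq_sum (e := e) he' hx' j]
  simp only [map_sum, map_smul, LinearMap.sum_apply, LinearMap.smul_apply, smul_eq_mul,
    Finset.mul_sum, Finset.sum_mul]
  refine Finset.sum_congr rfl fun k _ ↦ Finset.sum_congr rfl fun l _ ↦ ?_
  ring

lemma metricMatrix_eq (he' : e' ∈ IsManifold.maximalAtlas (𝓡 n) ∞ M) (hx' : x ∈ e'.source) :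
    metricMatrix g e x =
      (transitionMatrix e e' x)ᵀ * metricMatrix g e' x * transitionMatrix e e' x :=
  matrix_bilin_eq he' hx' (LinearMap.mk₂ ℝ (fun u v ↦ g.inner x u v) (by simp) (by simp) (by simp)
    (by simp))

lemma sqrtDet_eq (he' : e' ∈ IsManifold.maximalAtlas (𝓡 n) ∞ M) (hx' : x ∈ e'.source) :
    sqrtDet g e x = |(transitionMatrix e e' x).det| * sqrtDet g e' x := by
  rw [sqrtDet, metricMatrix_eq g he' hx', Matrix.det_mul, Matrix.det_mul, Matrix.det_transpose,
    mul_right_comm, Real.sqrt_mul (mul_self_nonneg _), Real.sqrt_mul_self_eq_abs, sqrtDet]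

/-- The metric serves as a tool here: √det g is positive in the chart `e` and carries the factor
|det P| relative to `e'`, so det P cannot vanish. -/
lemma isUnit_det_transitionMatrix
    (g : ContMDiffRiemannianMetric (𝓡 n) ∞ (EuclideanSpace ℝ (Fin n))
      (fun x : M ↦ TangentSpace (𝓡 n) x)) (he : e ∈ IsManifold.maximalAtlas (𝓡 n) ∞ M)
    (hx : x ∈ e.source) (he' : e' ∈ IsManifold.maximalAtlas (𝓡 n) ∞ M) (hx' : x ∈ e'.source) :
    IsUnit (transitionMatrix e e' x).det := by
  have h := sqrtDet_pos g he hx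
  rw [sqrtDet_eq g he' hx'] at h
  rw [isUnit_iff_ne_zero]
  intro h0
  simp [h0] at h

/-- The contraction is tr(G⁻¹ Bᵀ). Under G ↦ Pᵀ G P and B ↦ Pᵀ B P the factors P cancel by cyclicity
of the trace. -/
lemma sum_metricMatrix_inv_mul_bilin (he : e ∈ IsManifold.maximalAtlas (𝓡 n) ∞ M)
    (hx : x ∈ e.source) (he' : e' ∈ IsManifold.maximalAtlas (𝓡 n) ∞ M) (hx' : x ∈ e'.source)
    (b : TangentSpace (𝓡 n) x →ₗ[ℝ] TangentSpace (𝓡 n) x →ₗ[ℝ] ℝ) :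
    ∑ i, ∑ j, (metricMatrix g e x)⁻¹ i j * b (coordField e i x) (coordField e j x) =
      ∑ i, ∑ j, (metricMatrix g e' x)⁻¹ i j * b (coordField e' i x) (coordField e' j x) := by
  have tr (e) : ∑ i, ∑ j, (metricMatrix g e x)⁻¹ i j * b (coordField e i x) (coordField e j x) =
      ((metricMatrix g e x)⁻¹ *
        (Matrix.of fun i j ↦ b (coordField e i x) (coordField e j x))ᵀ).trace := by
    simp [Matrix.trace, Matrix.mul_apply]
  have hP := isUnit_det_transitionMatrix g he hx he' hx'
  have hP' : IsUnit (transitionMatrix e e' x)ᵀ.det := by rwa [Matrix.det_transpose]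
  rw [tr, tr, metricMatrix_eq g he' hx', matrix_bilin_eq he' hx' b]
  set P := transitionMatrix e e' x
  simp only [Matrix.mul_inv_rev, Matrix.transpose_mul, Matrix.transpose_transpose]
  rw [Matrix.trace_mul_comm]
  simp only [Matrix.mul_assoc]
  rw [← Matrix.mul_assoc P P⁻¹, Matrix.mul_nonsing_inv _ hP, Matrix.one_mul,
    Matrix.trace_mul_comm]
  simp only [Matrix.mul_assoc]
  rw [Matrix.nonsing_inv_mul _ hP', Matrix.mul_one, Matrix.trace_mul_comm]

end Metric

section HomInner

variable {n : ℕ} {M : Type*} [TopologicalSpace M] [ChartedSpace (EuclideanSpace ℝ (Fin n)) M]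
  [IsManifold (𝓡 n) ∞ M] {e e' : OpenPartialHomeomorph M (EuclideanSpace ℝ (Fin n))} {x : M}
  (g : ContMDiffRiemannianMetric (𝓡 n) ∞ (EuclideanSpace ℝ (Fin n))
    (fun x : M ↦ TangentSpace (𝓡 n) x))
  {F : Type*} [NormedAddCommGroup F] [NormedSpace ℝ F]
  {V : M → Type*} [TopologicalSpace (TotalSpace F V)]
  [∀ x, AddCommGroup (V x)] [∀ x, Module ℝ (V x)] [∀ x, TopologicalSpace (V x)]
  [∀ x, IsTopologicalAddGroup (V x)] [∀ x, ContinuousSMul ℝ (V x)]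
  [FiberBundle F V] [VectorBundle ℝ F V]
  (h : ContMDiffRiemannianMetric (𝓡 n) ∞ F V)

/-- `homInner` uses the preferred chart of each point, which may jump from point to point. Being
free to use one fixed chart is what allows it to be differentiated and integrated. -/
lemma homInner_eq (he : e ∈ IsManifold.maximalAtlas (𝓡 n) ∞ M) (hx : x ∈ e.source)
    (α β : TangentSpace (𝓡 n) x →L[ℝ] V x) :
    homInner g h x α β = ∑ i, ∑ j, (metricMatrix g e x)⁻¹ i j *
      h.inner x (α (coordField e i x)) (β (coordField e j x)) :=
  sum_metricMatrix_inv_mul_bilin g (IsManifold.chart_mem_maximalAtlas x) (mem_chart_source _ x)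
    he hx (LinearMap.mk₂ ℝ (fun u v ↦ h.inner x (α u) (β v)) (by simp) (by simp) (by simp)
    (by simp))

end HomInner

/-! ### Change of variables and the Riemannian measure. -/

section Transition

variable {n : ℕ} {M : Type*} [TopologicalSpace M] [ChartedSpace (EuclideanSpace ℝ (Fin n)) M]
  [IsManifold (𝓡 n) ∞ M] {e e' : OpenPartialHomeomorph M (EuclideanSpace ℝ (Fin n))} {x : M}

lemma hasFDerivAt_transition (he : e ∈ IsManifold.maximalAtlas (𝓡 n) ∞ M) (hx : x ∈ e.source)
    (he' : e' ∈ IsManifold.maximalAtlas (𝓡 n) ∞ M) (hx' : x ∈ e'.source) :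
    HasFDerivAt (e' ∘ e.symm) (((chartEquiv he' hx' : TangentSpace (𝓡 n) x →L[ℝ] _).comp
      ((chartEquiv he hx).symm : _ →L[ℝ] TangentSpace (𝓡 n) x))) (e x) := by
  have h1 : MDifferentiableAt (𝓡 n) (𝓡 n) e' (e.symm (e x)) := by
    rw [e.left_inv hx]
    exact (mdifferentiable_of_mem_maximalAtlas he').mdifferentiableAt hx'
  have h2 := (mdifferentiable_of_mem_maximalAtlas he).mdifferentiableAt_symm (e.map_source hx)
  have h3 := (h1.hasMFDerivAt.comp (e x) h2.hasMFDerivAt).hasFDerivAt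
  convert! h3 using 1
  ext v
  have h4 : mfderiv (𝓡 n) (𝓡 n) e' (e.symm (e x)) = mfderiv (𝓡 n) (𝓡 n) e' x := by
    rw [e.left_inv hx]
  rw [h4]
  rfl

lemma det_fderiv_transition (he : e ∈ IsManifold.maximalAtlas (𝓡 n) ∞ M) (hx : x ∈ e.source)
    (he' : e' ∈ IsManifold.maximalAtlas (𝓡 n) ∞ M) (hx' : x ∈ e'.source) :
    (fderiv ℝ (e' ∘ e.symm) (e x)).det = (transitionMatrix e e' x).det := by
  rw [(hasFDerivAt_transition he hx he' hx').fderiv, ContinuousLinearMap.det,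
    ← LinearMap.det_toMatrix (EuclideanSpace.basisFun (Fin n) ℝ).toBasis]
  congr 1
  ext k i
  simp only [LinearMap.toMatrix_apply, transitionMatrix, Matrix.of_apply,
    coordComponent_eq he' hx', coordField_eq he hx]
  simp

end Transition

section Volume

variable {n : ℕ} {M : Type*} [TopologicalSpace M] [ChartedSpace (EuclideanSpace ℝ (Fin n)) M]
  [IsManifold (𝓡 n) ∞ M] [MeasurableSpace M] [BorelSpace M]
  {e e' : OpenPartialHomeomorph M (EuclideanSpace ℝ (Fin n))}
  (g : ContMDiffRiemannianMetric (𝓡 n) ∞ (EuclideanSpace ℝ (Fin n))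
    (fun x : M ↦ TangentSpace (𝓡 n) x))

/-- Nothing is known about `e.symm` off the target, so the preimage is cut down to the open target,
where continuity applies. -/
lemma measurableSet_target_inter_symm_preimage {A : Set M} (hA : MeasurableSet A) :
    MeasurableSet (e.target ∩ e.symm ⁻¹' A) := by
  have h := (continuousOn_iff_continuous_domRestrict.1 e.continuousOn_symm).measurable hA
  have h2 := e.open_target.measurableSet.subtype_image h
  convert h2 using 1
  ext y
  simp [and_comm]

lemma aemeasurable_symm : AEMeasurable e.symm
    ((volume : Measure (EuclideanSpace ℝ (Fin n))).restrict e.target) :=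
  e.continuousOn_symm.aemeasurable e.open_target.measurableSet

lemma chartVolume_apply {A : Set M} (hA : MeasurableSet A) :
    chartVolume g e A =
      ∫⁻ y in e.target ∩ e.symm ⁻¹' A, ENNReal.ofReal (sqrtDet g e (e.symm y)) := by
  rw [chartVolume, Measure.map_apply_of_aemeasurable
    (aemeasurable_symm.mono_ac (withDensity_absolutelyContinuous _ _)) hA, withDensity_apply',
    Measure.restrict_restrict' e.open_target.measurableSet, Set.inter_comm]

/-- Change of variables along e' ∘ e.symm: its Jacobian |det P| is exactly the factor relating the
two values of √det g. -/
lemma chartVolume_eq_of_subset (he : e ∈ IsManifold.maximalAtlas (𝓡 n) ∞ M)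
    (he' : e' ∈ IsManifold.maximalAtlas (𝓡 n) ∞ M) {A : Set M} (hA : MeasurableSet A)
    (h : A ⊆ e.source) (h' : A ⊆ e'.source) : chartVolume g e A = chartVolume g e' A := by
  rw [chartVolume_apply g hA, chartVolume_apply g hA]
  set S := e.target ∩ e.symm ⁻¹' A
  have himg : (e' ∘ e.symm) '' S = e'.target ∩ e'.symm ⁻¹' A := by
    ext z
    constructor
    · rintro ⟨y, ⟨_, hyA⟩, rfl⟩
      refine ⟨e'.map_source (h' hyA), ?_⟩
      simpa [e'.left_inv (h' hyA)] using hyA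
    · rintro ⟨hz, hzA⟩
      refine ⟨e (e'.symm z), ⟨e.map_source (h hzA), ?_⟩, ?_⟩
      · simpa [e.left_inv (h hzA)] using hzA
      · simp [e.left_inv (h hzA), e'.right_inv hz]
  have hpt : ∀ y ∈ S, e.symm y ∈ e.source ∧ e.symm y ∈ e'.source ∧ e (e.symm y) = y :=
    fun y hy ↦ ⟨h hy.2, h' hy.2, e.right_inv hy.1⟩
  rw [← himg, lintegral_image_eq_lintegral_abs_det_fderiv_mul volume
    (measurableSet_target_inter_symm_preimage hA) (f' := fderiv ℝ (e' ∘ e.symm))]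
  · refine setLIntegral_congr_fun (measurableSet_target_inter_symm_preimage hA) fun y hy ↦ ?_
    obtain ⟨h1, h2, h3⟩ := hpt y hy
    have h4 := det_fderiv_transition he h1 he' h2
    rw [h3] at h4
    simp only [Function.comp_apply]
    rw [h4, e'.left_inv h2, sqrtDet_eq g he' h2, ENNReal.ofReal_mul (abs_nonneg _)]
  · intro y hy
    obtain ⟨h1, h2, h3⟩ := hpt y hy
    have h4 := (hasFDerivAt_transition he h1 he' h2).differentiableAt
    rw [h3] at h4
    exact h4.hasFDerivAt.hasFDerivWithinAt
  · intro y hy z hz hyz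
    have := e'.injOn (h' hy.2) (h' hz.2) hyz
    exact e.symm.injOn hy.1 hz.1 this

lemma chartVolume_restrict_source : (chartVolume g e).restrict e.source = chartVolume g e := by
  ext A hA
  rw [Measure.restrict_apply hA, chartVolume_apply g hA,
    chartVolume_apply g (hA.inter e.open_source.measurableSet)]
  congr 2
  ext y
  simp only [Set.mem_inter_iff, Set.mem_preimage]
  exact ⟨fun h ↦ ⟨h.1, h.2.1⟩, fun h ↦ ⟨h.1, h.2, e.map_target h.1⟩⟩

variable [SecondCountableTopology M]

/-- There is a measure on `M` which restricts to `√det g dx¹ ⋯ dxⁿ` on every chart. -/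
lemma exists_measure_restrict_source : ∃ μ : Measure M,
    ∀ e ∈ IsManifold.maximalAtlas (𝓡 n) ∞ M, μ.restrict e.source = chartVolume g e := by
  obtain ⟨s, hs, hcov⟩ := TopologicalSpace.countable_cover_nhds
    fun x : M ↦ chart_source_mem_nhds (EuclideanSpace ℝ (Fin n)) x
  -- An enumeration of the charts by ℕ needs at least one chart; otherwise M is empty.
  rcases s.eq_empty_or_nonempty with rfl | hne
  · have : IsEmpty M := by
      rw [Set.biUnion_empty] at hcov
      exact Set.univ_eq_empty_iff.1 hcov.symm
    exact ⟨0, fun e _ ↦ Subsingleton.elim _ _⟩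
  obtain ⟨c, hc⟩ := hs.exists_eq_range hne
  let ec : ℕ → OpenPartialHomeomorph M (EuclideanSpace ℝ (Fin n)) := fun k ↦ chartAt _ (c k)
  have hec (k) : ec k ∈ IsManifold.maximalAtlas (𝓡 n) ∞ M := IsManifold.chart_mem_maximalAtlas _
  -- Disjoint pieces ensure that overlaps of charts are counted once; on each piece any chart
  -- containing it gives the same measure.
  let D : ℕ → Set M := disjointed fun k ↦ (ec k).source
  have hDm (k) : MeasurableSet (D k) :=
    MeasurableSet.disjointed (fun k ↦ (ec k).open_source.measurableSet) k
  have hDs (k) : D k ⊆ (ec k).source := disjointed_subset _ k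
  have hD : ⋃ k, D k = Set.univ := by
    rw [iUnion_disjointed, ← hcov, hc, Set.biUnion_range]
  have hdisj : Pairwise (Function.onFun Disjoint D) := disjoint_disjointed _
  refine ⟨Measure.sum fun k ↦ (chartVolume g (ec k)).restrict (D k), fun e he ↦ ?_⟩
  ext A hA
  have hAe := hA.inter e.open_source.measurableSet
  rw [Measure.restrict_apply hA, Measure.sum_apply _ hAe]
  conv_rhs => rw [← chartVolume_restrict_source, Measure.restrict_apply hA]
  have h1 : A ∩ e.source = ⋃ k, (A ∩ e.source) ∩ D k := by
    rw [← Set.inter_iUnion, hD, Set.inter_univ]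
  conv_rhs => rw [h1]
  rw [measure_iUnion (fun i j hij ↦ (hdisj hij).mono Set.inter_subset_right Set.inter_subset_right)
    (fun k ↦ hAe.inter (hDm k))]
  refine tsum_congr fun k ↦ ?_
  rw [Measure.restrict_apply hAe]
  exact chartVolume_eq_of_subset g (hec k) he (hAe.inter (hDm k))
    (Set.inter_subset_right.trans (hDs k)) (fun y hy ↦ hy.1.2)

/-- The glued measure dominates every chart measure, hence dominates the supremum, which gives one
inequality after restriction; the other holds because the supremum dominates the measure of `e`. -/
lemma riemannianMeasure_restrict_source (he : e ∈ IsManifold.maximalAtlas (𝓡 n) ∞ M) :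
    (riemannianMeasure g).restrict e.source = chartVolume g e := by
  obtain ⟨μ, hμ⟩ := exists_measure_restrict_source g
  apply le_antisymm
  · have : riemannianMeasure g ≤ μ := iSup₂_le fun e he ↦ by
      rw [← hμ e he]; exact Measure.restrict_le_self
    rw [← hμ e he]
    exact Measure.restrict_mono le_rfl this
  · rw [← chartVolume_restrict_source]
    exact Measure.restrict_mono le_rfl (le_iSup₂ (f := fun e _ ↦ chartVolume g e) e he)

section Weighted

variable {f : M → ℝ}

lemma continuousOn_sqrtDet_comp_symm (he : e ∈ IsManifold.maximalAtlas (𝓡 n) ∞ M) :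
    ContinuousOn (fun y ↦ sqrtDet g e (e.symm y)) e.target := by
  intro y hy
  exact ((contMDiffAt_sqrtDet g he (e.map_target hy)).continuousAt.comp
    (e.continuousAt_symm hy)).continuousWithinAt

lemma weightedMeasure_restrict_source (he : e ∈ IsManifold.maximalAtlas (𝓡 n) ∞ M) :
    (weightedMeasure g f).restrict e.source =
      (chartVolume g e).withDensity fun x ↦ ENNReal.ofReal (Real.exp (-f x)) := by
  rw [weightedMeasure, restrict_withDensity e.open_source.measurableSet,
    riemannianMeasure_restrict_source g he]

lemma measurable_ofReal_exp_neg (hf : Continuous f) :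
    Measurable fun x ↦ ENNReal.ofReal (Real.exp (-f x)) :=
  (Real.continuous_exp.comp hf.neg).measurable.ennreal_ofReal

lemma setIntegral_weightedMeasure (he : e ∈ IsManifold.maximalAtlas (𝓡 n) ∞ M)
    (hf : Continuous f) {Φ : M → ℝ} (hΦ : Continuous Φ) :
    ∫ x in e.source, Φ x ∂(weightedMeasure g f) =
      ∫ y in e.target, Real.exp (-f (e.symm y)) * sqrtDet g e (e.symm y) * Φ (e.symm y) := by
  rw [weightedMeasure_restrict_source g he,
    integral_withDensity_eq_integral_toReal_smul (measurable_ofReal_exp_neg hf) (by simp),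
    chartVolume, integral_map (aemeasurable_symm.mono_ac (withDensity_absolutelyContinuous _ _)),
    integral_withDensity_eq_integral_toReal_smul₀
      ((continuousOn_sqrtDet_comp_symm g he).aemeasurable
        e.open_target.measurableSet).ennreal_ofReal (by simp)]
  · refine integral_congr_ae (Filter.Eventually.of_forall fun y ↦ ?_)
    have h0 : 0 ≤ sqrtDet g e (e.symm y) := Real.sqrt_nonneg _
    simp only [smul_eq_mul]
    rw [ENNReal.toReal_ofReal (Real.exp_pos _).le, ENNReal.toReal_ofReal h0]
    ring
  · exact ((measurable_ofReal_exp_neg hf).ennreal_toReal.smul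
      hΦ.measurable).aestronglyMeasurable

lemma isLocallyFiniteMeasure_weightedMeasure (hf : Continuous f) :
    IsLocallyFiniteMeasure (weightedMeasure g f) := by
  refine ⟨fun x ↦ ?_⟩
  set e := chartAt (EuclideanSpace ℝ (Fin n)) x
  have he : e ∈ IsManifold.maximalAtlas (𝓡 n) ∞ M := IsManifold.chart_mem_maximalAtlas x
  have hx : x ∈ e.source := mem_chart_source _ x
  -- The closed ball lies in the target and is compact, so the continuous density is integrable on
  -- it.
  obtain ⟨r, hr, hrt⟩ := Metric.nhds_basis_closedBall.mem_iff.1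
    (e.open_target.mem_nhds (e.map_source hx))
  set B := Metric.ball (e x) r
  have hU : IsOpen (e.source ∩ e ⁻¹' B) := e.isOpen_inter_preimage Metric.isOpen_ball
  refine ⟨e.source ∩ e ⁻¹' B, hU.mem_nhds ⟨hx, Metric.mem_ball_self hr⟩, ?_⟩
  have h1 : (weightedMeasure g f) (e.source ∩ e ⁻¹' B) =
      ∫⁻ y in e.target ∩ e.symm ⁻¹' (e.source ∩ e ⁻¹' B), ENNReal.ofReal (sqrtDet g e (e.symm y)) *
        ENNReal.ofReal (Real.exp (-f (e.symm y))) := by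
    have h0 : (weightedMeasure g f) (e.source ∩ e ⁻¹' B) =
        (weightedMeasure g f).restrict e.source (e.source ∩ e ⁻¹' B) := by
      rw [Measure.restrict_apply hU.measurableSet, Set.inter_eq_left.2 Set.inter_subset_left]
    rw [h0, weightedMeasure_restrict_source g he,
      withDensity_apply _ hU.measurableSet, chartVolume, ← lintegral_indicator hU.measurableSet,
      lintegral_map' ((measurable_ofReal_exp_neg hf).indicator hU.measurableSet).aemeasurable
        (aemeasurable_symm.mono_ac (withDensity_absolutelyContinuous _ _)),
      lintegral_withDensity_eq_lintegral_mul₀' ((continuousOn_sqrtDet_comp_symm g he).aemeasurable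
        e.open_target.measurableSet).ennreal_ofReal]
    · rw [← lintegral_indicator e.open_target.measurableSet,
        ← lintegral_indicator (measurableSet_target_inter_symm_preimage hU.measurableSet)]
      refine lintegral_congr fun y ↦ ?_
      by_cases hy : y ∈ e.target
      · have hys : e.symm y ∈ e.source := e.map_target hy
        rw [Set.indicator_of_mem hy]
        by_cases hB : e.symm y ∈ e.source ∩ e ⁻¹' B
        · have hy' : y ∈ e.target ∩ e.symm ⁻¹' (e.source ∩ e ⁻¹' B) := ⟨hy, hB⟩
          rw [Set.indicator_of_mem hy', Pi.mul_apply, Set.indicator_of_mem hB]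
        · have hy' : y ∉ e.target ∩ e.symm ⁻¹' (e.source ∩ e ⁻¹' B) := fun h ↦ hB h.2
          rw [Set.indicator_of_notMem hy', Pi.mul_apply, Set.indicator_of_notMem hB, mul_zero]
      · simp [Set.indicator, hy]
    · exact ((measurable_ofReal_exp_neg hf).indicator hU.measurableSet).comp_aemeasurable
        (aemeasurable_symm.mono_ac (withDensity_absolutelyContinuous _ _))
  have h2 : e.target ∩ e.symm ⁻¹' (e.source ∩ e ⁻¹' B) ⊆ Metric.closedBall (e x) r := by
    rintro y ⟨hy, hy'⟩
    have := hy'.2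
    simp only [Set.mem_preimage, e.right_inv hy] at this
    exact Metric.ball_subset_closedBall this
  have h3 : ContinuousOn (fun y ↦ sqrtDet g e (e.symm y) * Real.exp (-f (e.symm y)))
      (Metric.closedBall (e x) r) :=
    ((continuousOn_sqrtDet_comp_symm g he).mul (Real.continuous_exp.comp_continuousOn
      (hf.comp_continuousOn e.continuousOn_symm).neg)).mono hrt
  rw [h1]
  refine (lintegral_mono_set h2).trans_lt ?_
  have h4 (y) : ENNReal.ofReal (sqrtDet g e (e.symm y)) * ENNReal.ofReal (Real.exp (-f (e.symm y)))
      = ENNReal.ofReal (sqrtDet g e (e.symm y) * Real.exp (-f (e.symm y))) :=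
    (ENNReal.ofReal_mul (Real.sqrt_nonneg _)).symm
  simp_rw [h4]
  exact (h3.integrableOn_compact (isCompact_closedBall _ _)).lintegral_lt_top

lemma isOpenPosMeasure_weightedMeasure (hf : Continuous f) :
    (weightedMeasure g f).IsOpenPosMeasure := by
  refine ⟨fun U hU ⟨x, hxU⟩ h0 ↦ ?_⟩
  set e := chartAt (EuclideanSpace ℝ (Fin n)) x
  have he : e ∈ IsManifold.maximalAtlas (𝓡 n) ∞ M := IsManifold.chart_mem_maximalAtlas x
  have hx : x ∈ e.source := mem_chart_source _ x
  have h1 : riemannianMeasure g U = 0 :=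
    withDensity_absolutelyContinuous' (measurable_ofReal_exp_neg hf).aemeasurable
      (Filter.Eventually.of_forall fun y ↦ (ENNReal.ofReal_pos.2 (Real.exp_pos _)).ne') h0
  have h2 : chartVolume g e U = 0 := by
    rw [← riemannianMeasure_restrict_source g he]
    exact Measure.restrict_le_self.absolutelyContinuous h1
  rw [chartVolume, Measure.map_apply_of_aemeasurable
    (aemeasurable_symm.mono_ac (withDensity_absolutelyContinuous _ _)) hU.measurableSet] at h2
  -- The density √det g is positive on the target, so a null set for it is Lebesgue null; a nonempty
  -- open set is not.
  have h3 := withDensity_absolutelyContinuous' ((continuousOn_sqrtDet_comp_symm g he).aemeasurable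
        e.open_target.measurableSet).ennreal_ofReal
      ((ae_restrict_iff' e.open_target.measurableSet).2 (Filter.Eventually.of_forall fun y hy ↦
        (ENNReal.ofReal_pos.2 (sqrtDet_pos g he (e.map_target hy))).ne')) h2
  rw [Measure.restrict_apply' e.open_target.measurableSet, Set.inter_comm] at h3
  have h4 : IsOpen (e.target ∩ e.symm ⁻¹' U) := e.isOpen_inter_preimage_symm hU
  exact (h4.measure_pos volume ⟨e x, e.map_source hx, by simpa [e.left_inv hx] using hxU⟩).ne' h3

end Weighted

end Volume

/-! ### Global frames and smoothness of sections tested by inner products. -/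

section Smoothness

variable {n : ℕ} {M : Type*} [TopologicalSpace M] [ChartedSpace (EuclideanSpace ℝ (Fin n)) M]
  [IsManifold (𝓡 n) ∞ M] [T2Space M]
  {F : Type*} [NormedAddCommGroup F] [NormedSpace ℝ F] [FiniteDimensional ℝ F]
  {V : M → Type*} [TopologicalSpace (TotalSpace F V)]
  [∀ x, AddCommGroup (V x)] [∀ x, Module ℝ (V x)] [∀ x, TopologicalSpace (V x)]
  [∀ x, IsTopologicalAddGroup (V x)] [∀ x, ContinuousSMul ℝ (V x)]
  [FiberBundle F V] [VectorBundle ℝ F V] [ContMDiffVectorBundle ∞ F V (𝓡 n)]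
  (h : ContMDiffRiemannianMetric (𝓡 n) ∞ F V) {x : M}

/-- Near every point there are global smooth sections which form a basis of the fibres. -/
lemma exists_global_frame (F : Type*) [NormedAddCommGroup F] [NormedSpace ℝ F]
    [FiniteDimensional ℝ F]
    {V : M → Type*} [TopologicalSpace (TotalSpace F V)]
    [∀ x, AddCommGroup (V x)] [∀ x, Module ℝ (V x)] [∀ x, TopologicalSpace (V x)]
    [∀ x, IsTopologicalAddGroup (V x)] [∀ x, ContinuousSMul ℝ (V x)]
    [FiberBundle F V] [VectorBundle ℝ F V] [ContMDiffVectorBundle ∞ F V (𝓡 n)] (x : M) :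
    ∃ s : Fin (Module.finrank ℝ F) → Cₛ^∞⟮𝓡 n; F, V⟯, ∀ᶠ y in 𝓝 x,
      ∃ b : Module.Basis (Fin (Module.finrank ℝ F)) ℝ (V y), ∀ i, b i = s i y := by
  set t := trivializationAt F V x
  have hbase : t.baseSet ∈ 𝓝 x :=
    t.open_baseSet.mem_nhds (FiberBundle.mem_baseSet_trivializationAt F V x)
  obtain ⟨ψ, -, hψ⟩ := (SmoothBumpFunction.nhds_basis_tsupport (I := 𝓡 n) x).mem_iff.1 hbase
  let b := Module.finBasis ℝ F
  refine ⟨fun i ↦ ⟨fun y ↦ ψ y • t.localFrame b i y, ?_⟩, ?_⟩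
  · exact ContMDiffOn.smul_section_of_tsupport ψ.contMDiff.contMDiffOn t.open_baseSet
      hψ (t.contMDiffOn_localFrame_baseSet ∞ b i)
  · filter_upwards [hbase, ψ.eventuallyEq_one] with y hy hψy
    refine ⟨t.basisAt b hy, fun i ↦ ?_⟩
    have : ψ y = 1 := hψy
    simp [this, t.localFrame_apply_of_mem_baseSet b hy]

/-- A section is smooth if its inner products with all global smooth sections are. -/
lemma contMDiffAt_of_inner {W : (y : M) → V y}
    (hW : ∀ s : Cₛ^∞⟮𝓡 n; F, V⟯, ContMDiffAt (𝓡 n) 𝓘(ℝ, ℝ) ∞ (fun y ↦ h.inner y (s y) (W y)) x) :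
    ContMDiffAt (𝓡 n) ((𝓡 n).prod 𝓘(ℝ, F)) ∞ (fun y ↦ TotalSpace.mk' F y (W y)) x := by
  obtain ⟨s, hs⟩ := exists_global_frame (n := n) F (V := V) x
  let H : M → Matrix _ _ ℝ := fun y ↦ Matrix.of fun i j ↦ h.inner y (s i y) (s j y)
  have hdet : ∀ᶠ y in 𝓝 x, (H y).det ≠ 0 := by
    filter_upwards [hs] with y ⟨b, hb⟩
    have hli : LinearIndependent ℝ fun i ↦ s i y := by
      simpa only [← hb] using b.linearIndependent
    exact (posDef_gram h hli).det_pos.ne'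
  have hH (i j) : ContMDiffAt (𝓡 n) 𝓘(ℝ, ℝ) ∞ (fun y ↦ H y i j) x :=
    contMDiffAt_inner h (s i).contMDiff.contMDiffAt (s j).contMDiff.contMDiffAt
  -- The coefficients of W in the frame s, obtained by applying the inverse Gram matrix to the inner
  -- products h(s_j, W).
  let c : _ → M → ℝ := fun i y ↦ ∑ j, (H y)⁻¹ i j * h.inner y (s j y) (W y)
  have hc (i) : ContMDiffAt (𝓡 n) 𝓘(ℝ, ℝ) ∞ (c i) x :=
    contMDiffAt_finsetSum fun j _ ↦ (contMDiffAt_matrix_inv hH hdet.self_of_nhds i j).mul (hW (s j))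
  have hsum : ContMDiffAt (𝓡 n) ((𝓡 n).prod 𝓘(ℝ, F)) ∞
      (fun y ↦ TotalSpace.mk' F y (∑ i, (c i • fun z ↦ s i z) y)) x :=
    ContMDiffAt.sum_section fun i _ ↦ (hc i).smul_section (s i).contMDiff.contMDiffAt
  refine hsum.congr_of_eventuallyEq ?_
  filter_upwards [hs, hdet] with y ⟨b, hb⟩ hy
  congr 1
  refine inner_eq_of_forall h fun w ↦ ?_
  have hbasis (k) : h.inner y (s k y) (W y) = h.inner y (s k y) (∑ i, (c i • fun z ↦ s i z) y) := by
    have h1 : (H y * (H y)⁻¹) = 1 := Matrix.mul_nonsing_inv _ (isUnit_iff_ne_zero.2 hy)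
    have h2 : ∑ i, H y k i * c i y = h.inner y (s k y) (W y) := by
      have h3 : H y *ᵥ ((H y)⁻¹ *ᵥ fun j ↦ h.inner y (s j y) (W y)) =
          fun j ↦ h.inner y (s j y) (W y) := by
        rw [Matrix.mulVec_mulVec, h1, Matrix.one_mulVec]
      exact congrFun h3 k
    rw [← h2, map_sum]
    simp [H, mul_comm]
  rw [← b.sum_repr w, map_sum]
  simp only [map_smul, sum_apply, smul_apply, hb]
  exact Finset.sum_congr rfl fun k _ ↦ by rw [hbasis k]

end Smoothness

/-! ### The coordinate expression of the adjoint and its divergence identity. -/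

lemma contMDiffAt_exp_neg {n : ℕ} {M : Type*} [TopologicalSpace M]
    [ChartedSpace (EuclideanSpace ℝ (Fin n)) M] {f : M → ℝ}
    (hf : ContMDiff (𝓡 n) 𝓘(ℝ, ℝ) ∞ f) (x : M) :
    ContMDiffAt (𝓡 n) 𝓘(ℝ, ℝ) ∞ (fun y ↦ Real.exp (-f y)) x := by
  have h0 : ContDiffAt ℝ ∞ Real.exp (-f x) := Real.contDiff_exp.contDiffAt
  exact ContMDiffAt.comp (I' := 𝓘(ℝ, ℝ)) (g := Real.exp) (f := fun y ↦ -f y) x h0.contMDiffAt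
    hf.contMDiffAt.neg

section LocalAdjoint

variable {n : ℕ} {M : Type*} [TopologicalSpace M] [ChartedSpace (EuclideanSpace ℝ (Fin n)) M]
  [IsManifold (𝓡 n) ∞ M] {e : OpenPartialHomeomorph M (EuclideanSpace ℝ (Fin n))}
  (g : ContMDiffRiemannianMetric (𝓡 n) ∞ (EuclideanSpace ℝ (Fin n))
    (fun x : M ↦ TangentSpace (𝓡 n) x)) (f : M → ℝ)
  {F : Type*} [NormedAddCommGroup F] [NormedSpace ℝ F]
  {V : M → Type*} [TopologicalSpace (TotalSpace F V)]
  [∀ x, AddCommGroup (V x)] [∀ x, Module ℝ (V x)] [∀ x, TopologicalSpace (V x)]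
  [∀ x, IsTopologicalAddGroup (V x)] [∀ x, ContinuousSMul ℝ (V x)]
  [FiberBundle F V] [VectorBundle ℝ F V]
  (h : ContMDiffRiemannianMetric (𝓡 n) ∞ F V) {cov cov' : CovariantDerivative (𝓡 n) F V} {x : M}

/-- The coordinate expression in the chart `e` of the formal adjoint of `∇` applied to `η`, where
`cov' = ∇̃` is the dual connection. -/
def localAdjoint (cov' : CovariantDerivative (𝓡 n) F V)
    (e : OpenPartialHomeomorph M (EuclideanSpace ℝ (Fin n)))
    (η : (x : M) → TangentSpace (𝓡 n) x →L[ℝ] V x) (x : M) : V x :=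
  - (∑ i, ∑ j, (metricMatrix g e x)⁻¹ i j •
      cov' (fun y ↦ η y (coordField e i y)) x (coordField e j x))
  - (∑ i, ∑ j, (1 / sqrtDet g e x *
      partialDeriv e j (fun y ↦ sqrtDet g e y * (metricMatrix g e y)⁻¹ i j) x) •
        η x (coordField e i x))
  + ∑ i, ∑ j, ((metricMatrix g e x)⁻¹ i j * partialDeriv e j f x) • η x (coordField e i x)

lemma contMDiffAt_coordEval (he : e ∈ IsManifold.maximalAtlas (𝓡 n) ∞ M) (hx : x ∈ e.source)
    (η : Cₛ^∞⟮𝓡 n; EuclideanSpace ℝ (Fin n) →L[ℝ] F,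
      fun x : M ↦ TangentSpace (𝓡 n) x →L[ℝ] V x⟯) (i : Fin n) :
    ContMDiffAt (𝓡 n) ((𝓡 n).prod 𝓘(ℝ, F)) ∞
      (fun y ↦ TotalSpace.mk' F y (η y (coordField e i y))) x :=
  ContMDiffAt.clm_bundle_apply (F₁ := EuclideanSpace ℝ (Fin n)) (F₂ := F)
    η.contMDiff.contMDiffAt (contMDiffAt_coordField he hx i)

lemma partialDeriv_inner (hdual : IsDual h cov cov')
    (he : e ∈ IsManifold.maximalAtlas (𝓡 n) ∞ M) (hx : x ∈ e.source) {s t : (y : M) → V y}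
    (hs : ContMDiffAt (𝓡 n) ((𝓡 n).prod 𝓘(ℝ, F)) ∞ (fun y ↦ TotalSpace.mk' F y (s y)) x)
    (ht : ContMDiffAt (𝓡 n) ((𝓡 n).prod 𝓘(ℝ, F)) ∞ (fun y ↦ TotalSpace.mk' F y (t y)) x)
    (j : Fin n) :
    partialDeriv e j (fun y ↦ h.inner y (s y) (t y)) x =
      h.inner x (cov s x (coordField e j x)) (t x) +
        h.inner x (s x) (cov' t x (coordField e j x)) := by
  rw [partialDeriv_eq_mvfderiv he hx (contMDiffAt_inner h hs ht)]
  exact hdual s t x (hs.mdifferentiableAt (by simp)) (ht.mdifferentiableAt (by simp)) _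

variable [CovariantDerivative.ContMDiffCovariantDerivative cov ∞]

/-- Smoothness is assumed of ∇ only. Duality transfers it: h(s, ∇̃_j t) = ∂_j h(s, t) - h(∇_j s, t)
is smooth for every smooth s, and inner products detect smoothness. -/
lemma contMDiffAt_dual_coordField [T2Space M] [FiniteDimensional ℝ F]
    [ContMDiffVectorBundle ∞ F V (𝓡 n)] (hdual : IsDual h cov cov')
    (he : e ∈ IsManifold.maximalAtlas (𝓡 n) ∞ M) (hx : x ∈ e.source) {t : (y : M) → V y}
    (ht : ∀ y ∈ e.source,
      ContMDiffAt (𝓡 n) ((𝓡 n).prod 𝓘(ℝ, F)) ∞ (fun y ↦ TotalSpace.mk' F y (t y)) y)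
    (j : Fin n) :
    ContMDiffAt (𝓡 n) ((𝓡 n).prod 𝓘(ℝ, F)) ∞
      (fun y ↦ TotalSpace.mk' F y (cov' t y (coordField e j y))) x := by
  refine contMDiffAt_of_inner h fun s ↦ ?_
  have h1 := (contMDiffAt_partialDeriv he hx
    (contMDiffAt_inner h s.contMDiff.contMDiffAt (ht x hx)) j).sub
    (contMDiffAt_inner h (contMDiffAt_coordEval he hx (covSection cov s) j) (ht x hx))
  refine h1.congr_of_eventuallyEq ?_
  filter_upwards [e.open_source.mem_nhds hx] with y hy
  change _ = partialDeriv e j _ y - _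
  rw [partialDeriv_inner h hdual he hy s.contMDiff.contMDiffAt (ht y hy)]
  exact (add_sub_cancel_left _ _).symm

lemma contMDiffAt_localAdjoint [T2Space M] [FiniteDimensional ℝ F]
    [ContMDiffVectorBundle ∞ F V (𝓡 n)] (hf : ContMDiff (𝓡 n) 𝓘(ℝ, ℝ) ∞ f)
    (hdual : IsDual h cov cov') (he : e ∈ IsManifold.maximalAtlas (𝓡 n) ∞ M) (hx : x ∈ e.source)
    (η : Cₛ^∞⟮𝓡 n; EuclideanSpace ℝ (Fin n) →L[ℝ] F,
      fun x : M ↦ TangentSpace (𝓡 n) x →L[ℝ] V x⟯) :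
    ContMDiffAt (𝓡 n) ((𝓡 n).prod 𝓘(ℝ, F)) ∞
      (fun y ↦ TotalSpace.mk' F y (localAdjoint g f cov' e η y)) x := by
  have hη (i) := contMDiffAt_coordEval he hx η i
  have hinv (i j) := contMDiffAt_metricMatrix_inv g he hx i j
  have hsq := contMDiffAt_sqrtDet g he hx
  have hsq' : ContMDiffAt (𝓡 n) 𝓘(ℝ, ℝ) ∞ (fun y ↦ 1 / sqrtDet g e y) x := by
    simp only [one_div]
    exact (contDiffAt_inv ℝ (sqrtDet_pos g he hx).ne').contMDiffAt.comp x hsq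
  refine ((ContMDiffAt.neg_section ?_).sub_section ?_).add_section ?_ <;>
    refine ContMDiffAt.sum_section fun i _ ↦ ContMDiffAt.sum_section fun j _ ↦ ?_
  · exact (hinv i j).smul_section (contMDiffAt_dual_coordField h hdual he hx
      (fun y hy ↦ contMDiffAt_coordEval he hy η i) j)
  · exact (hsq'.mul (contMDiffAt_partialDeriv he hx (hsq.mul (hinv i j)) j)).smul_section (hη i)
  · exact ((hinv i j).mul (contMDiffAt_partialDeriv he hx hf.contMDiffAt j)).smul_section (hη i)

lemma contMDiffAt_homInner (x : M) (α β : Cₛ^∞⟮𝓡 n; EuclideanSpace ℝ (Fin n) →L[ℝ] F,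
      fun x : M ↦ TangentSpace (𝓡 n) x →L[ℝ] V x⟯) :
    ContMDiffAt (𝓡 n) 𝓘(ℝ, ℝ) ∞ (fun y ↦ homInner g h y (α y) (β y)) x := by
  have he := IsManifold.chart_mem_maximalAtlas (I := 𝓡 n) (n := ∞) x
  have hx := mem_chart_source (EuclideanSpace ℝ (Fin n)) x
  have h1 : ContMDiffAt (𝓡 n) 𝓘(ℝ, ℝ) ∞ (fun y ↦ ∑ i, ∑ j,
      (metricMatrix g (chartAt (EuclideanSpace ℝ (Fin n)) x) y)⁻¹ i j *
        h.inner y (α y (coordField (chartAt (EuclideanSpace ℝ (Fin n)) x) i y))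
          (β y (coordField (chartAt (EuclideanSpace ℝ (Fin n)) x) j y))) x :=
    contMDiffAt_finsetSum fun i _ ↦ contMDiffAt_finsetSum fun j _ ↦
      (contMDiffAt_metricMatrix_inv g he hx i j).mul (contMDiffAt_inner h
        (contMDiffAt_coordEval he hx α i) (contMDiffAt_coordEval he hx β j))
  refine h1.congr_of_eventuallyEq ?_
  filter_upwards [(chartAt (EuclideanSpace ℝ (Fin n)) x).open_source.mem_nhds hx] with y hy
  exact homInner_eq g h he hy _ _

/-- The divergence identity behind the formula for the formal adjoint. -/
lemma sum_partialDeriv_eq (hf : ContMDiff (𝓡 n) 𝓘(ℝ, ℝ) ∞ f)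
    (hdual : IsDual h cov cov') (he : e ∈ IsManifold.maximalAtlas (𝓡 n) ∞ M) (hx : x ∈ e.source)
    (η : Cₛ^∞⟮𝓡 n; EuclideanSpace ℝ (Fin n) →L[ℝ] F,
      fun x : M ↦ TangentSpace (𝓡 n) x →L[ℝ] V x⟯) (s : Cₛ^∞⟮𝓡 n; F, V⟯) :
    ∑ j, partialDeriv e j (fun y ↦ ∑ i, Real.exp (-f y) *
        ((sqrtDet g e y * (metricMatrix g e y)⁻¹ i j) *
          h.inner y (s y) (η y (coordField e i y)))) x =
      Real.exp (-f x) * sqrtDet g e x *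
        (homInner g h x (cov s x) (η x) - h.inner x (s x) (localAdjoint g f cov' e η x)) := by
  have hη (i) := contMDiffAt_coordEval he hx η i
  have hinv (i j) := contMDiffAt_metricMatrix_inv g he hx i j
  have hsq := contMDiffAt_sqrtDet g he hx
  have hs : ContMDiffAt (𝓡 n) ((𝓡 n).prod 𝓘(ℝ, F)) ∞ (fun y ↦ TotalSpace.mk' F y (s y)) x :=
    s.contMDiff.contMDiffAt
  have hexp := contMDiffAt_exp_neg hf x
  have hpos := sqrtDet_pos g he hx
  have hc (i j : Fin n) : ContMDiffAt (𝓡 n) 𝓘(ℝ, ℝ) ∞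
      (fun y ↦ sqrtDet g e y * (metricMatrix g e y)⁻¹ i j) x := hsq.mul (hinv i j)
  have hch (i j : Fin n) : ContMDiffAt (𝓡 n) 𝓘(ℝ, ℝ) ∞
      (fun y ↦ (sqrtDet g e y * (metricMatrix g e y)⁻¹ i j) *
        h.inner y (s y) (η y (coordField e i y))) x := (hc i j).mul (contMDiffAt_inner h hs (hη i))
  have key (i j : Fin n) : partialDeriv e j (fun y ↦ Real.exp (-f y) *
        ((sqrtDet g e y * (metricMatrix g e y)⁻¹ i j) *
          h.inner y (s y) (η y (coordField e i y)))) x =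
      Real.exp (-f x) * sqrtDet g e x * ((metricMatrix g e x)⁻¹ i j *
          h.inner x (cov s x (coordField e j x)) (η x (coordField e i x)) -
        (-((metricMatrix g e x)⁻¹ i j *
            h.inner x (s x) (cov' (fun y ↦ η y (coordField e i y)) x (coordField e j x)))
          - (1 / sqrtDet g e x *
            partialDeriv e j (fun y ↦ sqrtDet g e y * (metricMatrix g e y)⁻¹ i j) x) *
              h.inner x (s x) (η x (coordField e i x))
          + ((metricMatrix g e x)⁻¹ i j * partialDeriv e j f x) *
              h.inner x (s x) (η x (coordField e i x)))) := by
    rw [partialDeriv_mul he hx hexp (hch i j),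
      partialDeriv_mul he hx (hc i j) (contMDiffAt_inner h hs (hη i)),
      partialDeriv_inner h hdual he hx hs (hη i), partialDeriv_exp_neg he hx hf.contMDiffAt]
    field_simp
    ring
  have hsum (j : Fin n) : partialDeriv e j (fun y ↦ ∑ i, Real.exp (-f y) *
        ((sqrtDet g e y * (metricMatrix g e y)⁻¹ i j) *
          h.inner y (s y) (η y (coordField e i y)))) x =
      ∑ i, partialDeriv e j (fun y ↦ Real.exp (-f y) *
        ((sqrtDet g e y * (metricMatrix g e y)⁻¹ i j) *
          h.inner y (s y) (η y (coordField e i y)))) x :=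
    partialDeriv_sum he hx (fun i _ ↦ hexp.mul (hch i j)) j
  have hhom : homInner g h x (cov s x) (η x) = ∑ i, ∑ j, (metricMatrix g e x)⁻¹ i j *
      h.inner x (cov s x (coordField e j x)) (η x (coordField e i x)) := by
    rw [homInner_eq g h he hx, Finset.sum_comm]
    exact Finset.sum_congr rfl fun i _ ↦ Finset.sum_congr rfl fun j _ ↦ by
      rw [metricMatrix_inv_symm g j i]
  have hloc : h.inner x (s x) (localAdjoint g f cov' e η x) = ∑ i, ∑ j,
      (-((metricMatrix g e x)⁻¹ i j *
            h.inner x (s x) (cov' (fun y ↦ η y (coordField e i y)) x (coordField e j x)))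
          - (1 / sqrtDet g e x *
            partialDeriv e j (fun y ↦ sqrtDet g e y * (metricMatrix g e y)⁻¹ i j) x) *
              h.inner x (s x) (η x (coordField e i x))
          + ((metricMatrix g e x)⁻¹ i j * partialDeriv e j f x) *
              h.inner x (s x) (η x (coordField e i x))) := by
    simp only [localAdjoint, map_add, map_sub, map_neg, map_sum, map_smul, smul_eq_mul,
      Finset.sum_add_distrib, Finset.sum_sub_distrib, Finset.sum_neg_distrib]
  rw [hhom, hloc]
  simp only [hsum, key]
  rw [Finset.sum_comm]
  simp only [← Finset.mul_sum, Finset.sum_sub_distrib]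

end LocalAdjoint

/-! ### Vanishing of integrals of derivatives with compact support. -/

lemma integral_fderiv_apply_eq_zero {E : Type*} [NormedAddCommGroup E] [NormedSpace ℝ E]
    [FiniteDimensional ℝ E] [MeasurableSpace E] [BorelSpace E] (μ : Measure E)
    [μ.IsAddHaarMeasure] {w : E → ℝ} (hw : ContDiff ℝ 1 w) (hc : HasCompactSupport w) (v : E) :
    Integrable (fun y ↦ fderiv ℝ w y v) μ ∧ ∫ y, fderiv ℝ w y v ∂μ = 0 := by
  have hi : Integrable (fun y ↦ fderiv ℝ w y v) μ :=
    ((hw.continuous_fderiv one_ne_zero).clm_apply continuous_const).integrable_of_hasCompactSupport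
      (hc.fderiv_apply ℝ v)
  refine ⟨hi, ?_⟩
  -- Integration by parts against the constant function 1.
  have := integral_mul_fderiv_eq_neg_fderiv_mul_of_integrable (𝕜 := ℝ) (μ := μ) (f := fun _ ↦ 1)
    (g := w) (v := v) (by simp) (by simpa using hi)
    (by simpa using hw.continuous.integrable_of_hasCompactSupport hc)
    (fun x _ ↦ differentiableAt_const _) (fun x _ ↦ (hw.differentiable one_ne_zero).differentiableAt)
  simpa using this

section Stokes

variable {n : ℕ} {M : Type*} [TopologicalSpace M] [ChartedSpace (EuclideanSpace ℝ (Fin n)) M]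
  [IsManifold (𝓡 n) ∞ M] {e : OpenPartialHomeomorph M (EuclideanSpace ℝ (Fin n))}

lemma integral_partialDeriv_eq_zero (he : e ∈ IsManifold.maximalAtlas (𝓡 n) ∞ M) {φ : M → ℝ}
    {K : Set M} (hK : IsCompact K) (hKe : K ⊆ e.source)
    (hφ : ∀ x ∈ e.source, ContMDiffAt (𝓡 n) 𝓘(ℝ, ℝ) ∞ φ x) (h0 : ∀ x ∉ K, φ x = 0) (i : Fin n) :
    IntegrableOn (fun y ↦ partialDeriv e i φ (e.symm y)) e.target ∧
      ∫ y in e.target, partialDeriv e i φ (e.symm y) = 0 := by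
  -- Extension by zero from the target. It stays smooth because the image of K is compact, hence
  -- closed, and w vanishes off it.
  set w : EuclideanSpace ℝ (Fin n) → ℝ := e.target.indicator (φ ∘ e.symm) with hw
  have hK' : IsCompact (e '' K) := hK.image_of_continuousOn (e.continuousOn.mono hKe)
  have hw0 : ∀ y ∉ e '' K, w y = 0 := by
    intro y hy
    by_cases hyt : y ∈ e.target
    · rw [hw, Set.indicator_of_mem hyt]
      exact h0 _ fun hyK ↦ hy ⟨_, hyK, e.right_inv hyt⟩
    · exact Set.indicator_of_notMem hyt _
  have hloc : ∀ y ∈ e.target, w =ᶠ[𝓝 y] φ ∘ e.symm := fun y hy ↦ by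
    filter_upwards [e.open_target.mem_nhds hy] with z hz
    exact Set.indicator_of_mem hz _
  have hloc0 : ∀ y ∉ e '' K, w =ᶠ[𝓝 y] fun _ ↦ 0 := fun y hy ↦ by
    filter_upwards [hK'.isClosed.isOpen_compl.mem_nhds hy] with z hz
    exact hw0 z hz
  have hsub : e '' K ⊆ e.target := by
    rintro _ ⟨x, hx, rfl⟩
    exact e.map_source (hKe hx)
  have hsm : ContDiff ℝ 1 w := by
    rw [contDiff_iff_contDiffAt]
    intro y
    by_cases hy : y ∈ e.target
    · have h1 := contDiffAt_comp_symm he (e.map_target hy) (hφ _ (e.map_target hy))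
      rw [e.right_inv hy] at h1
      exact (h1.of_le (by simp)).congr_of_eventuallyEq (hloc y hy)
    · exact contDiffAt_const.congr_of_eventuallyEq (hloc0 y fun h ↦ hy (hsub h))
  obtain ⟨hi, hz⟩ := integral_fderiv_apply_eq_zero volume hsm (HasCompactSupport.intro hK' hw0)
    (EuclideanSpace.single i 1)
  have heq : Set.EqOn (fun y ↦ partialDeriv e i φ (e.symm y))
      (fun y ↦ fderiv ℝ w y (EuclideanSpace.single i 1)) e.target := fun y hy ↦ by
    simp only [partialDeriv]
    rw [e.right_inv hy, (hloc y hy).fderiv_eq]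
  refine ⟨hi.integrableOn.congr_fun heq.symm e.open_target.measurableSet, ?_⟩
  rw [setIntegral_congr_fun e.open_target.measurableSet heq,
    setIntegral_eq_integral_of_forall_compl_eq_zero, hz]
  intro y hy
  rw [(hloc0 y fun h ↦ hy (hsub h)).fderiv_eq]
  simp

end Stokes

/-! ### The global formal adjoint: existence and uniqueness. -/

section Adjoint

variable {n : ℕ} {M : Type*} [TopologicalSpace M] [ChartedSpace (EuclideanSpace ℝ (Fin n)) M]
  [IsManifold (𝓡 n) ∞ M] [T2Space M] [SecondCountableTopology M] [MeasurableSpace M] [BorelSpace M]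
  {e e' : OpenPartialHomeomorph M (EuclideanSpace ℝ (Fin n))}
  (g : ContMDiffRiemannianMetric (𝓡 n) ∞ (EuclideanSpace ℝ (Fin n))
    (fun x : M ↦ TangentSpace (𝓡 n) x)) {f : M → ℝ}
  {F : Type*} [NormedAddCommGroup F] [NormedSpace ℝ F]
  {V : M → Type*} [TopologicalSpace (TotalSpace F V)]
  [∀ x, AddCommGroup (V x)] [∀ x, Module ℝ (V x)] [∀ x, TopologicalSpace (V x)]
  [∀ x, IsTopologicalAddGroup (V x)] [∀ x, ContinuousSMul ℝ (V x)]
  [FiberBundle F V] [VectorBundle ℝ F V]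
  (h : ContMDiffRiemannianMetric (𝓡 n) ∞ F V) {cov cov' : CovariantDerivative (𝓡 n) F V} {x : M}

/-- A section orthogonal to all smooth sections with compact support in an open set vanishes
there. -/
lemma eq_zero_of_integral_inner_eq_zero [ContMDiffVectorBundle ∞ F V (𝓡 n)]
    (hf : Continuous f) {U : Set M} (hU : IsOpen U)
    (hx : x ∈ U) {D : (y : M) → V y}
    (hD : ∀ y ∈ U, ContMDiffAt (𝓡 n) ((𝓡 n).prod 𝓘(ℝ, F)) ∞ (fun y ↦ TotalSpace.mk' F y (D y)) y)
    (H : ∀ (s : Cₛ^∞⟮𝓡 n; F, V⟯) (K : Set M), IsCompact K → K ⊆ U → (∀ y ∉ K, s y = 0) →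
      ∫ y, h.inner y (s y) (D y) ∂(weightedMeasure g f) = 0) : D x = 0 := by
  obtain ⟨ψ, -, hψ⟩ :=
    (SmoothBumpFunction.nhds_basis_tsupport (I := 𝓡 n) x).mem_iff.1 (hU.mem_nhds hx)
  have hs := ContMDiffOn.smul_section_of_tsupport ψ.contMDiff.contMDiffOn hU hψ
    (fun y hy ↦ (hD y hy).contMDiffWithinAt)
  -- With this test section the integrand is ψ |D|², continuous, nonnegative, and positive at x if D
  -- x ≠ 0; the measure charges open sets, so its integral would be positive.
  let s : Cₛ^∞⟮𝓡 n; F, V⟯ := ⟨(ψ : M → ℝ) • D, hs⟩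
  have hs0 (y) (hy : y ∉ tsupport ψ) : s y = 0 := by
    change ψ y • D y = 0
    rw [image_eq_zero_of_notMem_tsupport hy, zero_smul]
  have hint := H s (tsupport ψ) ψ.hasCompactSupport.isCompact hψ hs0
  have hval (y) : h.inner y (s y) (D y) = ψ y * h.inner y (D y) (D y) := by
    change h.inner y (ψ y • D y) (D y) = _
    simp
  have hcont : Continuous fun y ↦ h.inner y (s y) (D y) := by
    rw [continuous_iff_continuousAt]
    intro y
    by_cases hy : y ∈ U
    · exact (contMDiffAt_inner h s.contMDiff.contMDiffAt (hD y hy)).continuousAt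
    · refine (continuousAt_const (y := (0 : ℝ))).congr ?_
      filter_upwards [(isClosed_tsupport ψ).isOpen_compl.mem_nhds fun hy' ↦ hy (hψ hy')] with z hz
      rw [hs0 z hz]
      simp
  have := isLocallyFiniteMeasure_weightedMeasure g hf
  have := isOpenPosMeasure_weightedMeasure g hf
  by_contra hne
  refine (hcont.integral_pos_of_hasCompactSupport_nonneg_nonzero (μ := weightedMeasure g f)
    (x := x) (HasCompactSupport.intro ψ.hasCompactSupport.isCompact fun y hy ↦ ?_)
    (fun y ↦ ?_) ?_).ne' hint
  · rw [hs0 y hy]; simp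
  · simp only [hval, Pi.zero_apply]
    refine mul_nonneg ψ.nonneg ?_
    by_cases hy : D y = 0
    · simp [hy]
    · exact (h.pos y _ hy).le
  · simp only [hval, ψ.eq_one, one_mul]
    exact (h.pos x _ hne).ne'

lemma cov_eq_zero_of_eventuallyEq (s : Cₛ^∞⟮𝓡 n; F, V⟯) (hs : ∀ᶠ y in 𝓝 x, s y = 0) :
    cov s x = 0 := by
  rw [cov.isCovariantDerivativeOnUniv.congr_of_eventuallyEq (σ' := 0) s.mdifferentiableAt
    (mdifferentiableAt_zeroSection ..) Filter.univ_mem hs, cov.zero]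
  rfl

lemma homInner_zero_left (β : TangentSpace (𝓡 n) x →L[ℝ] V x) : homInner g h x 0 β = 0 := by
  simp [homInner]

lemma homInner_add_left (α α' β : TangentSpace (𝓡 n) x →L[ℝ] V x) :
    homInner g h x (α + α') β = homInner g h x α β + homInner g h x α' β := by
  simp [homInner, mul_add, Finset.sum_add_distrib]

variable [CovariantDerivative.ContMDiffCovariantDerivative cov ∞]

lemma covSection_add (s t : Cₛ^∞⟮𝓡 n; F, V⟯) (x : M) :
    covSection cov (s + t) x = covSection cov s x + covSection cov t x := by
  change cov (⇑(s + t)) x = cov s x + cov t x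
  rw [ContMDiffSection.coe_add]
  exact cov.isCovariantDerivativeOnUniv.add s.mdifferentiableAt t.mdifferentiableAt

lemma continuous_homInner (α β : Cₛ^∞⟮𝓡 n; EuclideanSpace ℝ (Fin n) →L[ℝ] F,
      fun x : M ↦ TangentSpace (𝓡 n) x →L[ℝ] V x⟯) :
    Continuous fun y ↦ homInner g h y (α y) (β y) :=
  continuous_iff_continuousAt.2 fun x ↦ (contMDiffAt_homInner g h x α β).continuousAt

/-- The local adjoint is adjoint to `∇` on sections with compact support in the chart. -/
lemma integral_homInner_eq_of_subset_source [FiniteDimensional ℝ F]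
    [ContMDiffVectorBundle ∞ F V (𝓡 n)] (hf : ContMDiff (𝓡 n) 𝓘(ℝ, ℝ) ∞ f)
    (hdual : IsDual h cov cov') (he : e ∈ IsManifold.maximalAtlas (𝓡 n) ∞ M)
    (η : Cₛ^∞⟮𝓡 n; EuclideanSpace ℝ (Fin n) →L[ℝ] F,
      fun x : M ↦ TangentSpace (𝓡 n) x →L[ℝ] V x⟯) (s : Cₛ^∞⟮𝓡 n; F, V⟯)
    {K : Set M} (hK : IsCompact K) (hKe : K ⊆ e.source) (hs0 : ∀ y ∉ K, s y = 0) :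
    Integrable (fun y ↦ homInner g h y (covSection cov s y) (η y)) (weightedMeasure g f) ∧
    Integrable (fun y ↦ h.inner y (s y) (localAdjoint g f cov' e η y)) (weightedMeasure g f) ∧
    ∫ y, homInner g h y (covSection cov s y) (η y) ∂(weightedMeasure g f) =
      ∫ y, h.inner y (s y) (localAdjoint g f cov' e η y) ∂(weightedMeasure g f) := by
  have hKc : ∀ y ∉ K, ∀ᶠ z in 𝓝 y, s z = 0 := fun y hy ↦ by
    filter_upwards [hK.isClosed.isOpen_compl.mem_nhds hy] with z hz using hs0 z hz
  have hcov0 : ∀ y ∉ K, homInner g h y (covSection cov s y) (η y) = 0 := fun y hy ↦ by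
    change homInner g h y (cov s y) (η y) = 0
    rw [cov_eq_zero_of_eventuallyEq s (hKc y hy), homInner_zero_left]
  have hloc0 : ∀ y ∉ K, h.inner y (s y) (localAdjoint g f cov' e η y) = 0 := fun y hy ↦ by
    rw [hs0 y hy]; simp
  have hc1 := continuous_homInner g h (covSection cov s) η
  have hc2 : Continuous fun y ↦ h.inner y (s y) (localAdjoint g f cov' e η y) := by
    rw [continuous_iff_continuousAt]
    intro y
    by_cases hy : y ∈ e.source
    · exact (contMDiffAt_inner h s.contMDiff.contMDiffAt
        (contMDiffAt_localAdjoint g f h hf hdual he hy η)).continuousAt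
    · refine (continuousAt_const (y := (0 : ℝ))).congr ?_
      filter_upwards [hKc y fun hy' ↦ hy (hKe hy')] with z hz
      rw [hz]; simp
  have := isLocallyFiniteMeasure_weightedMeasure g hf.continuous
  have hi1 := hc1.integrable_of_hasCompactSupport (μ := weightedMeasure g f)
    (HasCompactSupport.intro hK hcov0)
  have hi2 := hc2.integrable_of_hasCompactSupport (μ := weightedMeasure g f)
    (HasCompactSupport.intro hK hloc0)
  refine ⟨hi1, hi2, ?_⟩
  -- The difference of the integrands vanishes off the chart; in coordinates, multiplied by ρ, it is
  -- the divergence from `sum_partialDeriv_eq`.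
  rw [← sub_eq_zero, ← integral_sub hi1 hi2,
    ← setIntegral_eq_integral_of_forall_compl_eq_zero (s := e.source) fun y hy ↦ by
      rw [hcov0 y fun hy' ↦ hy (hKe hy'), hloc0 y fun hy' ↦ hy (hKe hy'), sub_zero]]
  have hφ (j : Fin n) := integral_partialDeriv_eq_zero he (φ := fun y ↦ ∑ i, Real.exp (-f y) *
        ((sqrtDet g e y * (metricMatrix g e y)⁻¹ i j) *
          h.inner y (s y) (η y (coordField e i y)))) hK hKe
    (fun y hy ↦ contMDiffAt_finsetSum fun i _ ↦ (contMDiffAt_exp_neg hf y).mul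
      (((contMDiffAt_sqrtDet g he hy).mul (contMDiffAt_metricMatrix_inv g he hy i j)).mul
        (contMDiffAt_inner h s.contMDiff.contMDiffAt (contMDiffAt_coordEval he hy η i))))
    (fun y hy ↦ by simp [hs0 y hy]) j
  refine (setIntegral_weightedMeasure g he hf.continuous (hc1.sub hc2)).trans
    ((setIntegral_congr_fun e.open_target.measurableSet fun y hy ↦
      (sum_partialDeriv_eq g f h hf hdual he (e.map_target hy) η s).symm).trans ?_)
  rw [integral_finsetSum _ fun j _ ↦ (hφ j).1]
  exact Finset.sum_eq_zero fun j _ ↦ (hφ j).2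

variable [FiniteDimensional ℝ F] [ContMDiffVectorBundle ∞ F V (𝓡 n)]

/-- Both expressions are adjoint to ∇ on sections supported in the overlap, so their difference is
orthogonal to all of these and vanishes. -/
lemma localAdjoint_eq (hf : ContMDiff (𝓡 n) 𝓘(ℝ, ℝ) ∞ f)
    (hdual : IsDual h cov cov') (he : e ∈ IsManifold.maximalAtlas (𝓡 n) ∞ M)
    (hx : x ∈ e.source) (he' : e' ∈ IsManifold.maximalAtlas (𝓡 n) ∞ M) (hx' : x ∈ e'.source)
    (η : Cₛ^∞⟮𝓡 n; EuclideanSpace ℝ (Fin n) →L[ℝ] F,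
      fun x : M ↦ TangentSpace (𝓡 n) x →L[ℝ] V x⟯) :
    localAdjoint g f cov' e η x = localAdjoint g f cov' e' η x := by
  rw [← sub_eq_zero]
  refine eq_zero_of_integral_inner_eq_zero g h hf.continuous
    (D := fun y ↦ localAdjoint g f cov' e η y - localAdjoint g f cov' e' η y)
    (e.open_source.inter e'.open_source) ⟨hx, hx'⟩ (fun y hy ↦
      (contMDiffAt_localAdjoint g f h hf hdual he hy.1 η).sub_section
        (contMDiffAt_localAdjoint g f h hf hdual he' hy.2 η)) fun s K hK hKU hs0 ↦ ?_
  obtain ⟨-, hi, hl⟩ := integral_homInner_eq_of_subset_source g h hf hdual he η s hK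
    (hKU.trans Set.inter_subset_left) hs0
  obtain ⟨-, hi', hl'⟩ := integral_homInner_eq_of_subset_source g h hf hdual he' η s hK
    (hKU.trans Set.inter_subset_right) hs0
  simp only [map_sub]
  rw [integral_sub hi hi', ← hl, ← hl', sub_self]

/-- The formal adjoint of `∇`, given in each chart by the coordinate expression. -/
def adjoint (hf : ContMDiff (𝓡 n) 𝓘(ℝ, ℝ) ∞ f) (hdual : IsDual h cov cov')
    (η : Cₛ^∞⟮𝓡 n; EuclideanSpace ℝ (Fin n) →L[ℝ] F,
      fun x : M ↦ TangentSpace (𝓡 n) x →L[ℝ] V x⟯) : Cₛ^∞⟮𝓡 n; F, V⟯ where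
  toFun x := localAdjoint g f cov' (chartAt (EuclideanSpace ℝ (Fin n)) x) η x
  contMDiff_toFun x := by
    have he := IsManifold.chart_mem_maximalAtlas (I := 𝓡 n) (n := ∞) x
    have hx := mem_chart_source (EuclideanSpace ℝ (Fin n)) x
    refine (contMDiffAt_localAdjoint g f h hf hdual he hx η).congr_of_eventuallyEq ?_
    filter_upwards [(chartAt (EuclideanSpace ℝ (Fin n)) x).open_source.mem_nhds hx] with y hy
    rw [localAdjoint_eq g h hf hdual (IsManifold.chart_mem_maximalAtlas y) (mem_chart_source _ y)
      he hy η]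

lemma adjoint_apply (hf : ContMDiff (𝓡 n) 𝓘(ℝ, ℝ) ∞ f) (hdual : IsDual h cov cov')
    (η : Cₛ^∞⟮𝓡 n; EuclideanSpace ℝ (Fin n) →L[ℝ] F,
      fun x : M ↦ TangentSpace (𝓡 n) x →L[ℝ] V x⟯)
    (he : e ∈ IsManifold.maximalAtlas (𝓡 n) ∞ M) (hx : x ∈ e.source) :
    adjoint g h hf hdual η x = localAdjoint g f cov' e η x :=
  localAdjoint_eq g h hf hdual (IsManifold.chart_mem_maximalAtlas x) (mem_chart_source _ x) he hx η

lemma isFormalAdjoint_adjoint (hf : ContMDiff (𝓡 n) 𝓘(ℝ, ℝ) ∞ f) (hdual : IsDual h cov cov') :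
    IsFormalAdjoint g h f cov (adjoint g h hf hdual) := by
  intro η s hK
  have : LocallyCompactSpace M := ChartedSpace.locallyCompactSpace (EuclideanSpace ℝ (Fin n)) M
  set K := closure {x | s x ≠ 0}
  have hsK : ∀ y ∉ K, s y = 0 := fun y hy ↦ by
    by_contra hne
    exact hy (subset_closure hne)
  obtain ⟨ρ, hρ⟩ := SmoothPartitionOfUnity.exists_isSubordinate_chartAt_source (𝓡 n) M
  -- Integrability is part of the property because adjointness is additive only through additivity
  -- of the integral.
  let P : Cₛ^∞⟮𝓡 n; F, V⟯ → Prop := fun t ↦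
    Integrable (fun y ↦ homInner g h y (covSection cov t y) (η y)) (weightedMeasure g f) ∧
    Integrable (fun y ↦ h.inner y (t y) (adjoint g h hf hdual η y)) (weightedMeasure g f) ∧
    ∫ y, homInner g h y (covSection cov t y) (η y) ∂(weightedMeasure g f) =
      ∫ y, h.inner y (t y) (adjoint g h hf hdual η y) ∂(weightedMeasure g f)
  have hP0 : P 0 := by
    have h0 (y) : covSection cov (0 : Cₛ^∞⟮𝓡 n; F, V⟯) y = 0 :=
      cov_eq_zero_of_eventuallyEq _ (Filter.Eventually.of_forall fun _ ↦ rfl)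
    simp [P, h0, homInner_zero_left]
  have hPadd (t t') (ht : P t) (ht' : P t') : P (t + t') := by
    obtain ⟨h1, h2, h3⟩ := ht
    obtain ⟨h1', h2', h3'⟩ := ht'
    simp only [P, covSection_add, homInner_add_left, ContMDiffSection.coe_add, Pi.add_apply,
      map_add, add_apply]
    refine ⟨h1.add h1', h2.add h2', ?_⟩
    rw [integral_add h1 h1', integral_add h2 h2', h3, h3']
  let t : M → Cₛ^∞⟮𝓡 n; F, V⟯ := fun i ↦
    ⟨fun y ↦ ρ i y • s y, (ρ i).contMDiff.smul_section s.contMDiff⟩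
  have hPt (i) : P (t i) := by
    have he := IsManifold.chart_mem_maximalAtlas (I := 𝓡 n) (n := ∞) i
    have hcpt : IsCompact (tsupport (ρ i) ∩ K) := hK.inter_left (isClosed_tsupport _)
    have h0 : ∀ y ∉ tsupport (ρ i) ∩ K, t i y = 0 := fun y hy ↦ by
      change ρ i y • s y = 0
      by_cases hyK : y ∈ K
      · rw [image_eq_zero_of_notMem_tsupport fun hy' ↦ hy ⟨hy', hyK⟩, zero_smul]
      · rw [hsK y hyK, smul_zero]
    have hsub : tsupport (ρ i) ∩ K ⊆ (chartAt (EuclideanSpace ℝ (Fin n)) i).source :=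
      Set.inter_subset_left.trans (hρ i)
    have heq (y) : h.inner y (t i y) (adjoint g h hf hdual η y) =
        h.inner y (t i y) (localAdjoint g f cov' (chartAt (EuclideanSpace ℝ (Fin n)) i) η y) := by
      by_cases hy : y ∈ (chartAt (EuclideanSpace ℝ (Fin n)) i).source
      · rw [adjoint_apply g h hf hdual η he hy]
      · rw [h0 y fun hy' ↦ hy (hsub hy')]; simp
    simp only [P, heq]
    exact integral_homInner_eq_of_subset_source g h hf hdual he η (t i) hcpt hsub h0
  -- By local finiteness only finitely many functions of the partition are nonzero somewhere on K,
  -- so s is a finite sum of pieces supported in charts.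
  have hfin := ρ.locallyFinite.finite_nonempty_inter_compact hK
  have hsum : s = ∑ i ∈ hfin.toFinset, t i := by
    ext y
    have h1 : (∑ i ∈ hfin.toFinset, t i) y = ∑ i ∈ hfin.toFinset, ρ i y • s y := by
      have h2 := congrFun (map_sum (ContMDiffSection.coeAddHom (𝓡 n) F ∞ V) t hfin.toFinset) y
      rw [Finset.sum_apply] at h2
      exact h2
    rw [h1, ← Finset.sum_smul]
    by_cases hy : y ∈ K
    · have h3 := ρ.sum_eq_one (Set.mem_univ y)
      rw [finsum_eq_sum_of_support_subset _ (s := hfin.toFinset)] at h3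
      · rw [h3, one_smul]
      · intro i hi
        simp only [Set.Finite.coe_toFinset, Set.mem_ofPred_eq]
        exact ⟨y, hi, hy⟩
    · rw [hsK y hy, smul_zero]
  have hPs : P s := by
    rw [hsum]
    exact Finset.sum_induction t P hPadd hP0 fun i _ ↦ hPt i
  exact hPs.2.2

/-- Both images of η pair equally with every compactly supported section, so the test lemma applies
on all of M; linearity of B plays no role. -/
lemma IsFormalAdjoint.eq_adjoint (hf : ContMDiff (𝓡 n) 𝓘(ℝ, ℝ) ∞ f) (hdual : IsDual h cov cov')
    {B : Cₛ^∞⟮𝓡 n; EuclideanSpace ℝ (Fin n) →L[ℝ] F,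
      fun x : M ↦ TangentSpace (𝓡 n) x →L[ℝ] V x⟯ → Cₛ^∞⟮𝓡 n; F, V⟯}
    (hB : IsFormalAdjoint g h f cov B) : B = adjoint g h hf hdual := by
  funext η
  ext x
  rw [← sub_eq_zero]
  have := isLocallyFiniteMeasure_weightedMeasure g hf.continuous
  refine eq_zero_of_integral_inner_eq_zero g h hf.continuous isOpen_univ (Set.mem_univ x)
    (D := fun y ↦ B η y - adjoint g h hf hdual η y)
    (fun y _ ↦ (B η - adjoint g h hf hdual η).contMDiff.contMDiffAt) fun s K hK _ hs0 ↦ ?_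
  have hcl : IsCompact (closure {x | s x ≠ 0}) :=
    hK.of_isClosed_subset isClosed_closure (hK.isClosed.closure_subset_iff.2 fun y hy ↦ by
      by_contra hyK; exact hy (hs0 y hyK))
  have hi (t : Cₛ^∞⟮𝓡 n; F, V⟯) :
      Integrable (fun y ↦ h.inner y (s y) (t y)) (weightedMeasure g f) :=
    (continuous_iff_continuousAt.2 fun y ↦ (contMDiffAt_inner h s.contMDiff.contMDiffAt
      t.contMDiff.contMDiffAt).continuousAt).integrable_of_hasCompactSupport
        (HasCompactSupport.intro hK fun y hy ↦ by rw [hs0 y hy]; simp)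
  simp only [map_sub]
  rw [integral_sub (hi _) (hi _), ← hB η s hcl, ← isFormalAdjoint_adjoint g h hf hdual η s hcl,
    sub_self]

end Adjoint

/-! ### Jacobi's formula and the derivatives of √det g and g^{ij}. -/

lemma det_updateCol_eq_sum {ι : Type*} [Fintype ι] [DecidableEq ι] (A : Matrix ι ι ℝ) (k : ι)
    (v : ι → ℝ) : (A.updateCol k v).det = ∑ l, A.adjugate k l * v l := by
  rw [← Matrix.cramer_apply, Matrix.cramer_eq_adjugate_mulVec]
  rfl

/-- Jacobi's formula. -/
lemma hasFDerivAt_det {E ι : Type*} [NormedAddCommGroup E] [NormedSpace ℝ E] [Fintype ι]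
    [DecidableEq ι] {A : E → Matrix ι ι ℝ} {A' : Matrix ι ι (E →L[ℝ] ℝ)} {y : E}
    (hA : ∀ i j, HasFDerivAt (fun z ↦ A z i j) (A' i j) y) :
    HasFDerivAt (fun z ↦ (A z).det) (∑ k, ∑ l, (A y).adjugate k l • A' l k) y := by
  have h1 : HasFDerivAt (fun z ↦ (A z).det) (∑ σ : Equiv.Perm ι, ((Equiv.Perm.sign σ : ℤ) : ℝ) •
      ∑ k, (∏ l ∈ Finset.univ.erase k, A y (σ l) l) • A' (σ k) k) y := by
    simp only [Matrix.det_apply']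
    exact HasFDerivAt.fun_sum fun σ _ ↦
      HasFDerivAt.const_mul (HasFDerivAt.finsetProd fun k _ ↦ hA (σ k) k) _
  convert! h1 using 1
  ext v
  simp only [sum_apply, smul_apply, smul_eq_mul, Finset.mul_sum]
  conv_rhs => rw [Finset.sum_comm]
  refine Finset.sum_congr rfl fun k _ ↦ ?_
  -- The product-rule terms that differentiate column k add up to the determinant with that column
  -- replaced by its derivative, which Cramer's rule expresses through the adjugate.
  rw [← det_updateCol_eq_sum (A y) k fun l ↦ A' l k v, Matrix.det_apply']
  refine Finset.sum_congr rfl fun σ _ ↦ ?_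
  rw [← Finset.mul_prod_erase Finset.univ _ (Finset.mem_univ k), Matrix.updateCol_self]
  congr 1
  rw [mul_comm]
  congr 1
  refine Finset.prod_congr rfl fun l hl ↦ ?_
  rw [Matrix.updateCol_ne (Finset.ne_of_mem_erase hl)]

section Density

variable {n : ℕ} {M : Type*} [TopologicalSpace M] [ChartedSpace (EuclideanSpace ℝ (Fin n)) M]
  [IsManifold (𝓡 n) ∞ M] {e : OpenPartialHomeomorph M (EuclideanSpace ℝ (Fin n))} {x : M}
  (g : ContMDiffRiemannianMetric (𝓡 n) ∞ (EuclideanSpace ℝ (Fin n))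
    (fun x : M ↦ TangentSpace (𝓡 n) x))

lemma partialDeriv_det_metricMatrix (he : e ∈ IsManifold.maximalAtlas (𝓡 n) ∞ M)
    (hx : x ∈ e.source) (j : Fin n) :
    partialDeriv e j (fun y ↦ (metricMatrix g e y).det) x = (metricMatrix g e x).det *
      ∑ k, ∑ l, (metricMatrix g e x)⁻¹ k l * partialDeriv e j (fun y ↦ metricMatrix g e y k l) x := by
  have h1 (k l : Fin n) := (differentiableAt_comp_symm he hx
    (contMDiffAt_metricMatrix g he hx k l)).hasFDerivAt
  have h2 := hasFDerivAt_det (A := fun y ↦ metricMatrix g e (e.symm y)) (y := e x)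
    (A' := Matrix.of fun k l ↦ fderiv ℝ ((fun y ↦ metricMatrix g e y k l) ∘ e.symm) (e x)) h1
  have h3 : (metricMatrix g e x).adjugate =
      (metricMatrix g e x).det • (metricMatrix g e x)⁻¹ := by
    rw [Matrix.inv_def, Ring.inverse_eq_inv', smul_smul,
      mul_inv_cancel₀ (det_metricMatrix_pos g he hx).ne', one_smul]
  have h4 : partialDeriv e j (fun y ↦ (metricMatrix g e y).det) x = _ :=
    congrArg (fun L ↦ L (EuclideanSpace.single j (1 : ℝ))) h2.fderiv
  rw [h4]
  simp only [e.left_inv hx, h3, sum_apply, smul_apply, smul_eq_mul, Finset.mul_sum,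
    Matrix.smul_apply, Matrix.of_apply, mul_assoc]
  refine Finset.sum_congr rfl fun k _ ↦ Finset.sum_congr rfl fun l _ ↦ ?_
  have h5 : (fun y ↦ metricMatrix g e y l k) = fun y ↦ metricMatrix g e y k l :=
    funext fun y ↦ metricMatrix_symm g l k
  rw [h5]
  rfl

lemma partialDeriv_sqrtDet (he : e ∈ IsManifold.maximalAtlas (𝓡 n) ∞ M)
    (hx : x ∈ e.source) (j : Fin n) :
    partialDeriv e j (sqrtDet g e) x = sqrtDet g e x * ((1 / 2) *
      ∑ k, ∑ l, (metricMatrix g e x)⁻¹ k l *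
        partialDeriv e j (fun y ↦ metricMatrix g e y k l) x) := by
  have hsq := contMDiffAt_sqrtDet g he hx
  -- Differentiating (√det g)² = det g avoids the derivative of the square root.
  have h1 := partialDeriv_mul he hx hsq hsq j
  have h2 : partialDeriv e j (fun y ↦ sqrtDet g e y * sqrtDet g e y) x =
      partialDeriv e j (fun y ↦ (metricMatrix g e y).det) x := by
    refine partialDeriv_congr hx ?_ j
    filter_upwards [e.open_source.mem_nhds hx] with y hy
    exact Real.mul_self_sqrt (det_metricMatrix_pos g he hy).le
  have h3 : (metricMatrix g e x).det = sqrtDet g e x * sqrtDet g e x :=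
    (Real.mul_self_sqrt (det_metricMatrix_pos g he hx).le).symm
  rw [h2, partialDeriv_det_metricMatrix g he hx, h3] at h1
  have hpos := sqrtDet_pos g he hx
  apply mul_left_cancel₀ hpos.ne'
  linarith

/-- Derivative of G⁻¹ G = 1. The factor G stays on the left side because the identity is used after
pairing with ∂_m. -/
lemma sum_partialDeriv_inv_mul (he : e ∈ IsManifold.maximalAtlas (𝓡 n) ∞ M)
    (hx : x ∈ e.source) (j k m : Fin n) :
    ∑ i, partialDeriv e j (fun y ↦ (metricMatrix g e y)⁻¹ k i) x * metricMatrix g e x i m =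
      - ∑ i, (metricMatrix g e x)⁻¹ k i * partialDeriv e j (fun y ↦ metricMatrix g e y i m) x := by
  have hinv (i) := contMDiffAt_metricMatrix_inv g he hx k i
  have hm (i) := contMDiffAt_metricMatrix g he hx i m
  have h1 : partialDeriv e j
      (fun y ↦ ∑ i, (metricMatrix g e y)⁻¹ k i * metricMatrix g e y i m) x = 0 := by
    have h0 : partialDeriv e j (fun _ ↦ (1 : Matrix (Fin n) (Fin n) ℝ) k m) x = 0 := by
      simp only [partialDeriv]
      rw [show (fun _ : M ↦ (1 : Matrix (Fin n) (Fin n) ℝ) k m) ∘ e.symm = fun _ ↦ _ from rfl]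
      simp
    rw [← h0]
    refine partialDeriv_congr hx ?_ j
    filter_upwards [e.open_source.mem_nhds hx] with y hy
    rw [← Matrix.mul_apply,
      Matrix.nonsing_inv_mul _ (isUnit_iff_ne_zero.2 (det_metricMatrix_pos g he hy).ne')]
  have h2 : partialDeriv e j
      (fun y ↦ ∑ i, (metricMatrix g e y)⁻¹ k i * metricMatrix g e y i m) x =
      ∑ i, partialDeriv e j (fun y ↦ (metricMatrix g e y)⁻¹ k i * metricMatrix g e y i m) x :=
    partialDeriv_sum he hx (fun i _ ↦ (hinv i).mul (hm i)) j
  rw [h2] at h1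
  simp only [partialDeriv_mul he hx (hinv _) (hm _), Finset.sum_add_distrib] at h1
  linarith

end Density

/-! ### Statistical manifolds: Christoffel symbols and the Hessian. -/

section Statistical

variable {n : ℕ} {M : Type*} [TopologicalSpace M] [ChartedSpace (EuclideanSpace ℝ (Fin n)) M]
  [IsManifold (𝓡 n) ∞ M] {e : OpenPartialHomeomorph M (EuclideanSpace ℝ (Fin n))} {x : M}
  (g : ContMDiffRiemannianMetric (𝓡 n) ∞ (EuclideanSpace ℝ (Fin n))
    (fun x : M ↦ TangentSpace (𝓡 n) x))
  {cov cov' : CovariantDerivative (𝓡 n) (EuclideanSpace ℝ (Fin n))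
    (fun x : M ↦ TangentSpace (𝓡 n) x)}

/-- Lie brackets commute with pullback, and constant fields on ℝⁿ have zero bracket. -/
lemma mlieBracket_coordField (he : e ∈ IsManifold.maximalAtlas (𝓡 n) ∞ M) (hx : x ∈ e.source)
    (i j : Fin n) : VectorField.mlieBracket (𝓡 n) (coordField e i) (coordField e j) x = 0 := by
  have hc (k : Fin n) : MDifferentiableAt (𝓡 n) ((𝓡 n).prod (𝓡 n))
      (fun y ↦ (TotalSpace.mk' (EuclideanSpace ℝ (Fin n)) y
        (EuclideanSpace.single k (1 : ℝ) : EuclideanSpace ℝ (Fin n)) :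
        TangentBundle (𝓡 n) (EuclideanSpace ℝ (Fin n)))) (e x) :=
    (contMDiffAt_vectorSpace_iff_contDiffAt (n := 1).2 contDiffAt_const).mdifferentiableAt
      one_ne_zero
  have : IsManifold (𝓡 n) (minSmoothness ℝ 2) M := by
    rw [minSmoothness_of_isRCLikeNormedField]; infer_instance
  have h1 := VectorField.mpullback_mlieBracket (n := ∞) (hc i) (hc j)
    (contMDiffAt_of_mem_maximalAtlas he hx)
    (by rw [minSmoothness_of_isRCLikeNormedField]; exact ENat.LEInfty.out)
  have h2 (a b : EuclideanSpace ℝ (Fin n)) :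
      VectorField.lieBracketWithin ℝ (fun _ ↦ a) (fun _ ↦ b) Set.univ = 0 := by
    ext1 y
    simp [VectorField.lieBracketWithin]
  have h3 (a b : EuclideanSpace ℝ (Fin n)) :
      VectorField.mlieBracket (𝓡 n) (fun _ : EuclideanSpace ℝ (Fin n) ↦ a) (fun _ ↦ b) = 0 := by
    exact VectorField.mlieBracketWithin_univ.symm.trans
      (VectorField.mlieBracketWithin_eq_lieBracketWithin.trans (h2 a b))
  refine h1.symm.trans ((congrArg (fun W ↦ VectorField.mpullback (𝓡 n) (𝓡 n) e W x)
    (h3 _ _)).trans ?_)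
  exact congrFun VectorField.mpullback_zero x

lemma cov_coordField_symm (hcov : cov.torsion = 0) (he : e ∈ IsManifold.maximalAtlas (𝓡 n) ∞ M)
    (hx : x ∈ e.source) (j k : Fin n) :
    cov (coordField e k) x (coordField e j x) = cov (coordField e j) x (coordField e k x) := by
  have h := (CovariantDerivative.torsion_eq_zero_iff cov).1 hcov
    ((contMDiffAt_coordField he hx j).mdifferentiableAt (by simp))
    ((contMDiffAt_coordField he hx k).mdifferentiableAt (by simp))
  rw [mlieBracket_coordField he hx] at h
  exact sub_eq_zero.1 h

lemma diffTensor_apply (u : TangentSpace (𝓡 n) x) {Y : (y : M) → TangentSpace (𝓡 n) y}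
    (hY : ContMDiffAt (𝓡 n) ((𝓡 n).prod (𝓡 n)) ∞
      (fun y ↦ TotalSpace.mk' (EuclideanSpace ℝ (Fin n)) y (Y y)) x) :
    diffTensor cov cov' x u (Y x) = cov' Y x u - cov Y x u := by
  have h := IsCovariantDerivativeOn.difference_apply cov'.isCovariantDerivativeOnUniv
    cov.isCovariantDerivativeOnUniv (Set.mem_univ x) (hY.mdifferentiableAt (by simp))
  exact congrArg (fun L ↦ L u) h

end Statistical

/-- The algebra behind the Christoffel symbols: `a` and `a'` are the Christoffel symbols of two
dual torsion-free connections and `d` is the derivative of the metric. -/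
lemma contract_christoffel {ι : Type*} [Fintype ι] {G : ι → ι → ℝ} {a a' d : ι → ι → ι → ℝ}
    (hG : ∀ i j, G i j = G j i) (ha : ∀ i j k, a i j k = a j i k) (ha' : ∀ i j k, a' i j k = a' j i k)
    (hd : ∀ j k l, d j k l = a j k l + a' j l k) (hd' : ∀ j k l, d j k l = d j l k) (m : ι) :
    1 / 2 * ∑ k, ∑ l, G k l * d m k l - ∑ j, ∑ i, G j i * d j i m =
      -(1 / 2) * ∑ j, ∑ k, G j k * (a j k m + a' j k m) := by
  have e1 : ∑ k, ∑ l, G k l * d m k l =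
      ∑ k, ∑ l, G k l * a k m l + ∑ k, ∑ l, G k l * a' k m l := by
    have h : ∑ k, ∑ l, G k l * a' m l k = ∑ k, ∑ l, G k l * a' k m l := by
      rw [Finset.sum_comm]
      refine Finset.sum_congr rfl fun k _ ↦ Finset.sum_congr rfl fun l _ ↦ ?_
      rw [hG l k, ha' m k l]
    simp only [hd, mul_add, Finset.sum_add_distrib, h]
    simp only [ha m]
  have e2 : ∑ j, ∑ i, G j i * d j i m =
      ∑ k, ∑ l, G k l * a k l m + ∑ k, ∑ l, G k l * a' k m l := by
    simp only [hd, mul_add, Finset.sum_add_distrib]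
  -- The same contraction as in `e2`, expanded after exchanging the last two indices of d. Averaging
  -- `e2` and `e3` yields all of half of `e1`, which cancels, and leaves only the symbols contracted
  -- in their first two indices.
  have e3 : ∑ j, ∑ i, G j i * d j i m =
      ∑ k, ∑ l, G k l * a k m l + ∑ k, ∑ l, G k l * a' k l m := by
    simp only [hd' _ _ m]
    simp only [hd, mul_add, Finset.sum_add_distrib]
  simp only [mul_add, Finset.sum_add_distrib]
  linarith

section Statistical

variable {n : ℕ} {M : Type*} [TopologicalSpace M] [ChartedSpace (EuclideanSpace ℝ (Fin n)) M]
  [IsManifold (𝓡 n) ∞ M] {e : OpenPartialHomeomorph M (EuclideanSpace ℝ (Fin n))} {x : M}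
  (g : ContMDiffRiemannianMetric (𝓡 n) ∞ (EuclideanSpace ℝ (Fin n))
    (fun x : M ↦ TangentSpace (𝓡 n) x)) {f : M → ℝ}
  {cov cov' : CovariantDerivative (𝓡 n) (EuclideanSpace ℝ (Fin n))
    (fun x : M ↦ TangentSpace (𝓡 n) x)}

lemma partialDeriv_sqrtDet_mul_inv (he : e ∈ IsManifold.maximalAtlas (𝓡 n) ∞ M)
    (hx : x ∈ e.source) (i j : Fin n) :
    1 / sqrtDet g e x *
        partialDeriv e j (fun y ↦ sqrtDet g e y * (metricMatrix g e y)⁻¹ i j) x =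
      (1 / 2 * ∑ k, ∑ l, (metricMatrix g e x)⁻¹ k l *
        partialDeriv e j (fun y ↦ metricMatrix g e y k l) x) * (metricMatrix g e x)⁻¹ i j +
      partialDeriv e j (fun y ↦ (metricMatrix g e y)⁻¹ i j) x := by
  have hpos := sqrtDet_pos g he hx
  rw [partialDeriv_mul he hx (contMDiffAt_sqrtDet g he hx)
    (contMDiffAt_metricMatrix_inv g he hx i j), partialDeriv_sqrtDet g he hx]
  field_simp

lemma eq_of_inner_coordField (he : e ∈ IsManifold.maximalAtlas (𝓡 n) ∞ M) (hx : x ∈ e.source)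
    {a b : TangentSpace (𝓡 n) x}
    (hab : ∀ m, g.inner x (coordField e m x) a = g.inner x (coordField e m x) b) : a = b := by
  refine inner_eq_of_forall g fun w ↦ ?_
  rw [← (coordBasis he hx).sum_repr w, map_sum]
  simp only [map_smul, sum_apply, smul_apply, coordBasis_apply]
  exact Finset.sum_congr rfl fun m _ ↦ by rw [hab m]

/-- On a statistical manifold, the derivative of the Riemannian density is the metric trace of the
average of the two connections. -/
lemma sum_partialDeriv_sqrtDet_mul_inv (hst : IsStatistical g cov cov')
    (he : e ∈ IsManifold.maximalAtlas (𝓡 n) ∞ M) (hx : x ∈ e.source) :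
    ∑ i, ∑ j, (1 / sqrtDet g e x *
        partialDeriv e j (fun y ↦ sqrtDet g e y * (metricMatrix g e y)⁻¹ i j) x) •
          coordField e i x =
      (-(1 / 2) : ℝ) • ∑ j, ∑ k, (metricMatrix g e x)⁻¹ j k •
        (cov (coordField e k) x (coordField e j x) +
          cov' (coordField e k) x (coordField e j x)) := by
  -- Pairing with ∂_m lowers the index, so that everything is stated in Christoffel symbols of the
  -- first kind.
  have hmain (m : Fin n) : g.inner x (coordField e m x) (∑ i, ∑ j, (1 / sqrtDet g e x *
        partialDeriv e j (fun y ↦ sqrtDet g e y * (metricMatrix g e y)⁻¹ i j) x) •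
          coordField e i x) = g.inner x (coordField e m x)
      ((-(1 / 2) : ℝ) • ∑ j, ∑ k, (metricMatrix g e x)⁻¹ j k •
        (cov (coordField e k) x (coordField e j x) +
          cov' (coordField e k) x (coordField e j x))) := by
    have hd (j k l : Fin n) : partialDeriv e j (fun y ↦ metricMatrix g e y k l) x =
        g.inner x (coordField e l x) (cov (coordField e k) x (coordField e j x)) +
        g.inner x (coordField e k x) (cov' (coordField e l) x (coordField e j x)) := by
      rw [g.symm x (coordField e l x)]
      exact partialDeriv_inner g hst.dual he hx (contMDiffAt_coordField he hx k)
        (contMDiffAt_coordField he hx l) j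
    have key := contract_christoffel
      (a := fun j k l ↦ g.inner x (coordField e l x) (cov (coordField e k) x (coordField e j x)))
      (a' := fun j k l ↦ g.inner x (coordField e l x) (cov' (coordField e k) x (coordField e j x)))
      (metricMatrix_inv_symm g (e := e) (x := x))
      (fun j k l ↦ by rw [cov_coordField_symm hst.torsion_eq_zero he hx j k])
      (fun j k l ↦ by rw [cov_coordField_symm hst.torsion_eq_zero' he hx j k]) hd
      (fun j k l ↦ by simp only [metricMatrix_symm g k l]) m
    have h1 (j : Fin n) : ∑ i, (metricMatrix g e x)⁻¹ i j * metricMatrix g e x m i =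
        if m = j then 1 else 0 := by
      rw [← Matrix.one_apply, ← Matrix.mul_nonsing_inv (metricMatrix g e x)
        (isUnit_iff_ne_zero.2 (det_metricMatrix_pos g he hx).ne'), Matrix.mul_apply]
      exact Finset.sum_congr rfl fun i _ ↦ mul_comm _ _
    have h2 (j : Fin n) : ∑ i, partialDeriv e j (fun y ↦ (metricMatrix g e y)⁻¹ i j) x *
        metricMatrix g e x m i = - ∑ i, (metricMatrix g e x)⁻¹ j i *
          partialDeriv e j (fun y ↦ metricMatrix g e y i m) x := by
      rw [← sum_partialDeriv_inv_mul g he hx]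
      refine Finset.sum_congr rfl fun i _ ↦ ?_
      rw [metricMatrix_symm g m i]
      simp only [metricMatrix_inv_symm g i j]
    simp only [map_sum, map_smul, map_add, smul_eq_mul]
    rw [← key, Finset.sum_comm]
    simp only [partialDeriv_sqrtDet_mul_inv g he hx]
    have h3 (j : Fin n) : ∑ i, ((1 / 2 * ∑ k, ∑ l, (metricMatrix g e x)⁻¹ k l *
        partialDeriv e j (fun y ↦ metricMatrix g e y k l) x) * (metricMatrix g e x)⁻¹ i j +
        partialDeriv e j (fun y ↦ (metricMatrix g e y)⁻¹ i j) x) *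
          g.inner x (coordField e m x) (coordField e i x) =
        (1 / 2 * ∑ k, ∑ l, (metricMatrix g e x)⁻¹ k l *
          partialDeriv e j (fun y ↦ metricMatrix g e y k l) x) * (if m = j then 1 else 0) -
        ∑ i, (metricMatrix g e x)⁻¹ j i *
          partialDeriv e j (fun y ↦ metricMatrix g e y i m) x := by
      generalize 1 / 2 * ∑ k, ∑ l, (metricMatrix g e x)⁻¹ k l *
        partialDeriv e j (fun y ↦ metricMatrix g e y k l) x = T
      rw [sub_eq_add_neg, ← h2, ← h1, Finset.mul_sum, ← Finset.sum_add_distrib]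
      refine Finset.sum_congr rfl fun i _ ↦ ?_
      rw [← metricMatrix_apply]
      ring
    simp only [h3, Finset.sum_sub_distrib, mul_ite, mul_one, mul_zero]
    simp
  exact eq_of_inner_coordField g he hx hmain

/-- K^i ∂_i is the coordinate expansion of the vector g^{jk} K_{∂_j} ∂_k. -/
lemma sum_diffTrace_smul (he : e ∈ IsManifold.maximalAtlas (𝓡 n) ∞ M) (hx : x ∈ e.source) :
    ∑ i, diffTrace g cov cov' e i x • coordField e i x =
      ∑ j, ∑ k, (metricMatrix g e x)⁻¹ j k • cov' (coordField e k) x (coordField e j x) -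
      ∑ j, ∑ k, (metricMatrix g e x)⁻¹ j k • cov (coordField e k) x (coordField e j x) := by
  simp only [diffTrace, Finset.sum_smul, mul_smul]
  rw [Finset.sum_comm, ← Finset.sum_sub_distrib]
  refine Finset.sum_congr rfl fun j _ ↦ ?_
  rw [Finset.sum_comm, ← Finset.sum_sub_distrib]
  refine Finset.sum_congr rfl fun k _ ↦ ?_
  rw [← Finset.smul_sum, sum_coordComponent_smul he hx, ← smul_sub,
    diffTensor_apply _ (contMDiffAt_coordField he hx k)]

variable [CovariantDerivative.ContMDiffCovariantDerivative cov ∞]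

/-- With T = g^{jk} ∇_j ∂_k and T̃ = g^{jk} ∇̃_j ∂_k, the density term contributes ½ ∇_{T+T̃} X. The
Hessian contributes ∇_{T̃} X, and subtracting ½ ∇_{T̃-T} X, the K term, restores the balance. -/
lemma localAdjoint_eq_hess (hst : IsStatistical g cov cov')
    (he : e ∈ IsManifold.maximalAtlas (𝓡 n) ∞ M) (hx : x ∈ e.source)
    (X : (y : M) → TangentSpace (𝓡 n) y) :
    localAdjoint g f cov' e (cov X) x =
      - traceSecondCov g cov cov' e X x
      - (1 / 2 : ℝ) • ∑ i, diffTrace g cov cov' e i x • cov X x (coordField e i x)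
      + ∑ i, ∑ j, ((metricMatrix g e x)⁻¹ i j * partialDeriv e j f x) •
          cov X x (coordField e i x) := by
  have h1 := congrArg (cov X x) (sum_partialDeriv_sqrtDet_mul_inv g hst he hx)
  have h2 := congrArg (cov X x) (sum_diffTrace_smul g (cov := cov) (cov' := cov') he hx)
  -- The two traces list the coordinate fields in opposite orders; symmetry of the Christoffel
  -- symbols of ∇̃ exchanges them.
  have h3 : ∑ i, ∑ j, (metricMatrix g e x)⁻¹ i j •
      cov X x (cov' (coordField e i) x (coordField e j x)) =
      ∑ i, ∑ j, (metricMatrix g e x)⁻¹ i j •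
        cov X x (cov' (coordField e j) x (coordField e i x)) := by
    simp only [cov_coordField_symm hst.torsion_eq_zero' he hx]
  simp only [map_sum, map_smul, map_sub, map_add, smul_add, Finset.sum_add_distrib] at h1 h2
  simp only [localAdjoint, traceSecondCov, secondCov, smul_sub, Finset.sum_sub_distrib, h1, h2]
  rw [h3]
  module

/-- Changing the outer connection from ∇ to ∇̃ adds K acting on the value ∇_i X and subtracts K
acting on the slot ∂_i; the trace of the latter is K^i ∇_i X. -/
lemma traceSecondCov_eq (hst : IsStatistical g cov cov')
    (he : e ∈ IsManifold.maximalAtlas (𝓡 n) ∞ M) (hx : x ∈ e.source)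
    (X : Cₛ^∞⟮𝓡 n; EuclideanSpace ℝ (Fin n), fun x : M ↦ TangentSpace (𝓡 n) x⟯) :
    traceSecondCov g cov cov' e X x = traceSecondCov g cov cov e X x
      + (∑ i, ∑ j, (metricMatrix g e x)⁻¹ i j •
          diffTensor cov cov' x (coordField e j x) (cov X x (coordField e i x)))
      - ∑ i, diffTrace g cov cov' e i x • cov X x (coordField e i x) := by
  have h2 := congrArg (cov X x) (sum_diffTrace_smul g (cov := cov) (cov' := cov') he hx)
  have h3 : ∑ i, ∑ j, (metricMatrix g e x)⁻¹ i j •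
      cov X x (cov' (coordField e i) x (coordField e j x)) =
      ∑ i, ∑ j, (metricMatrix g e x)⁻¹ i j •
        cov X x (cov' (coordField e j) x (coordField e i x)) := by
    simp only [cov_coordField_symm hst.torsion_eq_zero' he hx]
  have h4 : ∑ i, ∑ j, (metricMatrix g e x)⁻¹ i j •
      cov X x (cov (coordField e i) x (coordField e j x)) =
      ∑ i, ∑ j, (metricMatrix g e x)⁻¹ i j •
        cov X x (cov (coordField e j) x (coordField e i x)) := by
    simp only [cov_coordField_symm hst.torsion_eq_zero he hx]
  have h5 (i j : Fin n) : diffTensor cov cov' x (coordField e j x) (cov X x (coordField e i x)) =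
      cov' (fun y ↦ cov X y (coordField e i y)) x (coordField e j x) -
        cov (fun y ↦ cov X y (coordField e i y)) x (coordField e j x) :=
    diffTensor_apply (coordField e j x) (contMDiffAt_coordEval he hx (covSection cov X) i)
  simp only [map_sum, map_smul, map_sub] at h2
  simp only [traceSecondCov, secondCov, smul_sub, Finset.sum_sub_distrib, h2, h5]
  rw [h3, h4]
  abel

end Statistical

end StatLaplacian

end

theorem theorem3p2 {n : ℕ} {M : Type*} [TopologicalSpace M]
    [ChartedSpace (EuclideanSpace ℝ (Fin n)) M] [IsManifold (𝓡 n) ∞ M]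
    [T2Space M] [SecondCountableTopology M] [MeasurableSpace M] [BorelSpace M]
    (g : ContMDiffRiemannianMetric (𝓡 n) ∞ (EuclideanSpace ℝ (Fin n))
      (fun x : M ↦ TangentSpace (𝓡 n) x))
    (f : M → ℝ) (hf : ContMDiff (𝓡 n) 𝓘(ℝ, ℝ) ∞ f) :
    -- the coordinate formula on an arbitrary vector bundle with bundle metric `h`
    (∀ {F : Type*} [NormedAddCommGroup F] [NormedSpace ℝ F] [FiniteDimensional ℝ F]
      {V : M → Type*} [TopologicalSpace (TotalSpace F V)]
      [∀ x, AddCommGroup (V x)] [∀ x, Module ℝ (V x)] [∀ x, TopologicalSpace (V x)]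
      [∀ x, IsTopologicalAddGroup (V x)] [∀ x, ContinuousSMul ℝ (V x)]
      [FiberBundle F V] [VectorBundle ℝ F V] [ContMDiffVectorBundle ∞ F V (𝓡 n)]
      (h : ContMDiffRiemannianMetric (𝓡 n) ∞ F V)
      (cov cov' : CovariantDerivative (𝓡 n) F V) [CovariantDerivative.ContMDiffCovariantDerivative cov ∞],
      StatLaplacian.IsDual h cov cov' →
      ∃ A : Cₛ^∞⟮𝓡 n; EuclideanSpace ℝ (Fin n) →L[ℝ] F,
          fun x : M ↦ TangentSpace (𝓡 n) x →L[ℝ] V x⟯ → Cₛ^∞⟮𝓡 n; F, V⟯,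
        StatLaplacian.IsFormalAdjoint g h f cov A ∧
        (∀ B, StatLaplacian.IsFormalAdjoint g h f cov B → B = A) ∧
        ∀ s : Cₛ^∞⟮𝓡 n; F, V⟯, ∀ e ∈ IsManifold.maximalAtlas (𝓡 n) ∞ M, ∀ x ∈ e.source,
          A (StatLaplacian.covSection cov s) x =
            - (∑ i, ∑ j, (StatLaplacian.metricMatrix g e x)⁻¹ i j •
                cov' (fun y ↦ cov s y (StatLaplacian.coordField e i y)) x
                  (StatLaplacian.coordField e j x))
            - (∑ i, ∑ j, (1 / StatLaplacian.sqrtDet g e x *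
                StatLaplacian.partialDeriv e j (fun y ↦ StatLaplacian.sqrtDet g e y *
                  (StatLaplacian.metricMatrix g e y)⁻¹ i j) x) •
                cov s x (StatLaplacian.coordField e i x))
            + ∑ i, ∑ j, ((StatLaplacian.metricMatrix g e x)⁻¹ i j *
                StatLaplacian.partialDeriv e j f x) •
                cov s x (StatLaplacian.coordField e i x)) ∧
    -- the formulas on the tangent bundle of a statistical manifold
    (∀ (cov cov' : CovariantDerivative (𝓡 n) (EuclideanSpace ℝ (Fin n))
        (fun x : M ↦ TangentSpace (𝓡 n) x)) [CovariantDerivative.ContMDiffCovariantDerivative cov ∞],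
      StatLaplacian.IsStatistical g cov cov' →
      ∃ A : Cₛ^∞⟮𝓡 n; EuclideanSpace ℝ (Fin n) →L[ℝ] EuclideanSpace ℝ (Fin n),
          fun x : M ↦ TangentSpace (𝓡 n) x →L[ℝ] TangentSpace (𝓡 n) x⟯ →
          Cₛ^∞⟮𝓡 n; EuclideanSpace ℝ (Fin n), fun x : M ↦ TangentSpace (𝓡 n) x⟯,
        StatLaplacian.IsFormalAdjoint g g f cov A ∧
        (∀ B, StatLaplacian.IsFormalAdjoint g g f cov B → B = A) ∧
        ∀ X : Cₛ^∞⟮𝓡 n; EuclideanSpace ℝ (Fin n), fun x : M ↦ TangentSpace (𝓡 n) x⟯,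
        ∀ e ∈ IsManifold.maximalAtlas (𝓡 n) ∞ M, ∀ x ∈ e.source,
          -- with `Hess X = ∇̃∇X`
          A (StatLaplacian.covSection cov X) x =
            - StatLaplacian.traceSecondCov g cov cov' e X x
            - (1 / 2 : ℝ) • ∑ i, StatLaplacian.diffTrace g cov cov' e i x •
                cov X x (StatLaplacian.coordField e i x)
            + ∑ i, ∑ j, ((StatLaplacian.metricMatrix g e x)⁻¹ i j *
                StatLaplacian.partialDeriv e j f x) •
                cov X x (StatLaplacian.coordField e i x) ∧
          -- the same operator through `∇∇X`
          A (StatLaplacian.covSection cov X) x =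
            - StatLaplacian.traceSecondCov g cov cov e X x
            - (∑ i, ∑ j, (StatLaplacian.metricMatrix g e x)⁻¹ i j •
                StatLaplacian.diffTensor cov cov' x (StatLaplacian.coordField e j x)
                  (cov X x (StatLaplacian.coordField e i x)))
            + (1 / 2 : ℝ) • ∑ i, StatLaplacian.diffTrace g cov cov' e i x •
                cov X x (StatLaplacian.coordField e i x)
            + ∑ i, ∑ j, ((StatLaplacian.metricMatrix g e x)⁻¹ i j *
                StatLaplacian.partialDeriv e j f x) •
                cov X x (StatLaplacian.coordField e i x)) := by
  refine ⟨?_, ?_⟩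
  · intro F _ _ _ V _ _ _ _ _ _ _ _ _ h cov cov' _ hdual
    exact ⟨StatLaplacian.adjoint g h hf hdual, StatLaplacian.isFormalAdjoint_adjoint g h hf hdual,
      fun B hB ↦ StatLaplacian.IsFormalAdjoint.eq_adjoint g h hf hdual hB,
      fun s e he x hx ↦ StatLaplacian.adjoint_apply g h hf hdual _ he hx⟩
  · intro cov cov' _ hst
    refine ⟨StatLaplacian.adjoint g g hf hst.dual,
      StatLaplacian.isFormalAdjoint_adjoint g g hf hst.dual,
      fun B hB ↦ StatLaplacian.IsFormalAdjoint.eq_adjoint g g hf hst.dual hB,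
      fun X e he x hx ↦ ?_⟩
    have h1 := (StatLaplacian.adjoint_apply g g hf hst.dual
      (StatLaplacian.covSection cov X) he hx).trans
        (StatLaplacian.localAdjoint_eq_hess g hst he hx X)
    exact ⟨h1, by rw [h1, StatLaplacian.traceSecondCov_eq g hst he hx X]; module⟩
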